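/- Let $d\ge 1$, $\Omega=(0,2\pi)^d$, $\phi_k(x)=(2\pi)^{-d/2}e^{ik\cdot x}$ for $k\in\mathbb{Z}^d$, let $V=H^1_p(\Omega)$ be the space of $2\pi$-periodic complex $H^1$ functions with norm $\|v\|^2=\|v\|_{L^2}^2+\|\nabla v\|_{L^2}^2$, and let $V'=H^{-1}_p(\Omega)$ be the space of continuous conjugate-linear forms on $V$ with the dual norm. Let $\nu,\sigma$ be real measurable coefficients on $\Omega$ that are bounded above and bounded below by positive constants, and let $$a(u,v)=\int_\Omega \nu\,\nabla u\cdot\nabla\bar v+\int_\Omega\sigma u\bar v,\qquad \langle Lu,v\rangle=a(u,v)\qquad (u,v\in V).$$ Let $|\cdot|$ denote the Euclidean norm on $\mathbb{Z}^d$, let $c_k=\sqrt{1+|k|^2}$, and let $\mathbf A=(a_{\ell,k})$ with $a_{\ell,k}=a(\phi_k,\phi_\ell)/(c_\ell c_k)$ be the stiffness matrix (which is Hermitian, positive definite and boundedly invertible on $\ell^2(\mathbb{Z}^d)$). For $v\in V$ put $P_\Lambda v=\sum_{k\in\Lambda}\hat v_k\phi_k$ with $\hat v_k=\int_\Omega v\,\overline{\phi_k}$;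 for $g\in V'$ put $P_\Lambda g=\sum_{k\in\Lambda}\hat g_k\phi_k$ with $\hat g_k=\langle g,\phi_k\rangle$, where $\phi_k$ is identified with the form $v\mapsto\int_\Omega\phi_k\bar v$. For $w$ in $V$ or $V'$, with $\|\cdot\|$ the norm of that space, let $E_N(w)=\inf\{\|w-P_\Lambda w\| : \Lambda\subset\mathbb{Z}^d,\ |\Lambda|=N\}$, and for $s>0$ let $$\|w\|_{\mathcal A^s_B}=\|w\|+\sup_{N\ge1}E_N(w)\,N^{s/d},$$ where $w\in\mathcal A^s_B$ means that this quantity is finite. Assume that $\mathbf A$ has algebraic off-diagonal decay of order $\eta_L>d$, that is, there is a constant $c_L>0$ with $|a_{\ell,k}|\le c_L(1+|\ell-k|)^{-\eta_L}$ for all $\ell,k\in\mathbb{Z}^d$, and let $0<s<\eta_L-d$. Then there is a constant $C$ (depending on $d$, $\nu$, $\sigma$, $\eta_L$, $s$ only) such that the following holds. Let $f\in V'$ and let $u\in V$ be the weak solution of $Lu=f$, that is, $a(u,v)=\langle f,v\rangle$ for all $v\in V$, and suppose that $u\in\mathcal A^s_B$. For every finite index set $\Lambda\subset\mathbb{Z}^d$,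 let $u_\Lambda\in V_\Lambda=\mathrm{span}\{\phi_k:k\in\Lambda\}$ be the Galerkin approximation, that is, $a(u_\Lambda,v)=\langle f,v\rangle$ for all $v\in V_\Lambda$. Then the residual $r(u_\Lambda)=f-Lu_\Lambda\in V'$ belongs to $\mathcal A^s_B$ and $$\|r(u_\Lambda)\|_{\mathcal A^s_B}\le C\,\|u\|_{\mathcal A^s_B}.$$ -/

import Mathlib

open MeasureTheory Set
open scoped ContDiff ENNReal

namespace FourierGalerkin

noncomputable section

/-! ### The periodic cell and the space `L²(Ω)` -/

/-- The cell `Ω = (0, 2π)^d`. -/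
def Ω (d : ℕ) : Set (Fin d → ℝ) :=
  Set.pi univ fun _ => Ioo 0 (2 * Real.pi)

/-- Lebesgue measure on `Ω`. -/
abbrev μΩ (d : ℕ) : Measure (Fin d → ℝ) :=
  (volume : Measure (Fin d → ℝ)).restrict (Ω d)

/-- The complex Hilbert space `L²(Ω)`. -/
abbrev L2 (d : ℕ) := Lp ℂ 2 (μΩ d)

theorem Ω_subset (d : ℕ) : Ω d ⊆ Icc (fun _ => 0) (fun _ => 2 * Real.pi) := by
  intro x hx
  exact ⟨fun i => (hx i (mem_univ i)).1.le, fun i => (hx i (mem_univ i)).2.le⟩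

theorem measurableSet_Ω (d : ℕ) : MeasurableSet (Ω d) :=
  MeasurableSet.univ_pi fun _ => measurableSet_Ioo

instance instFiniteΩ (d : ℕ) : IsFiniteMeasure (μΩ d) := by
  constructor
  rw [Measure.restrict_apply_univ]
  exact lt_of_le_of_lt (measure_mono (Ω_subset d)) isCompact_Icc.measure_lt_top

theorem memLp_of_continuous {d : ℕ} {g : (Fin d → ℝ) → ℂ} (hg : Continuous g) :
    MemLp g 2 (μΩ d) := by
  obtain ⟨C, hC⟩ := (isCompact_Icc (a := fun _ : Fin d => (0 : ℝ))
    (b := fun _ => 2 * Real.pi)).exists_bound_of_continuousOn hg.continuousOn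
  refine MemLp.of_bound hg.aestronglyMeasurable C ?_
  filter_upwards [ae_restrict_mem (measurableSet_Ω d)] with x hx
  exact hC x (Ω_subset d hx)

/-! ### Periodic test functions and the Sobolev space `H¹_p(Ω)` -/

/-- `ψ` is `2π`-periodic in each coordinate. -/
def IsPeriodic {d : ℕ} (ψ : (Fin d → ℝ) → ℂ) : Prop :=
  ∀ (j : Fin d) (x : Fin d → ℝ), ψ (x + Pi.single j (2 * Real.pi)) = ψ x

/-- The classical partial derivative `∂ψ/∂x_j`. -/
def pderiv {d : ℕ} (j : Fin d) (ψ : (Fin d → ℝ) → ℂ) (x : Fin d → ℝ) : ℂ :=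
  fderiv ℝ ψ x (Pi.single j 1)

/-- `g = (g_1, …, g_d)` is the weak gradient of `v` in the periodic sense: the integration by parts
formula holds, without boundary terms, against every smooth function that is `2π`-periodic in
each coordinate. Besides `g = ∇v` in the distributions on `Ω`, this expresses that the traces of
`v` on opposite faces of `Ω` agree. -/
def IsPeriodicWeakGradient {d : ℕ} (v : (Fin d → ℝ) → ℂ) (g : Fin d → (Fin d → ℝ) → ℂ) : Prop :=
  ∀ ψ : (Fin d → ℝ) → ℂ, ContDiff ℝ ∞ ψ → IsPeriodic ψ → ∀ j : Fin d,
    ∫ x in Ω d, v x * pderiv j ψ x = - ∫ x in Ω d, g j x * ψ x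

theorem continuous_pderiv {d : ℕ} {ψ : (Fin d → ℝ) → ℂ} (hψ : ContDiff ℝ ∞ ψ) (j : Fin d) :
    Continuous (pderiv j ψ) :=
  (hψ.continuous_fderiv (by simp)).clm_apply continuous_const

theorem integrable_mul_continuous {d : ℕ} (f : L2 d) {g : (Fin d → ℝ) → ℂ} (hg : Continuous g) :
    Integrable (fun x => f x * g x) (μΩ d) :=
  (Lp.memLp f).integrable_mul (memLp_of_continuous hg)

/-- The Hilbert space `L²(Ω) × L²(Ω)^d`, normed by `‖(v, g)‖² = ‖v‖² + ∑ j, ‖g_j‖²`. -/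
abbrev L2Pair (d : ℕ) := WithLp 2 (L2 d × PiLp 2 (fun _ : Fin d => L2 d))

/-- The space `H¹_p(Ω)` of periodic `H¹` functions. Its elements are written as pairs `(v, ∇v)`
of an `L²` function and its weak gradient (which `v` determines), so that the norm inherited
from `L2Pair d` is the `H¹` norm `(‖v‖² + ‖∇v‖²)^(1/2)`. -/
def H1p (d : ℕ) : Submodule ℂ (L2Pair d) where
  carrier := {p | IsPeriodicWeakGradient (p.fst : (Fin d → ℝ) → ℂ)
    (fun j => (p.snd j : (Fin d → ℝ) → ℂ))}
  zero_mem' := by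
    intro ψ _ _ j
    have h1 : (fun x => ((0 : L2 d) : (Fin d → ℝ) → ℂ) x * pderiv j ψ x)
        =ᵐ[μΩ d] fun _ => 0 := by
      filter_upwards [Lp.coeFn_zero ℂ 2 (μΩ d)] with x hx
      rw [hx, Pi.zero_apply, zero_mul]
    have h2 : (fun x => ((0 : L2 d) : (Fin d → ℝ) → ℂ) x * ψ x) =ᵐ[μΩ d] fun _ => 0 := by
      filter_upwards [Lp.coeFn_zero ℂ 2 (μΩ d)] with x hx
      rw [hx, Pi.zero_apply, zero_mul]
    have h3 := integral_congr_ae h1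
    have h4 := integral_congr_ae h2
    simp only [WithLp.zero_fst, WithLp.zero_snd, PiLp.zero_apply]
    rw [h3, h4]
    simp
  add_mem' := by
    intro p q hp hq ψ hψ hper j
    have h1 : (fun x => ((p.fst + q.fst : L2 d) : (Fin d → ℝ) → ℂ) x * pderiv j ψ x)
        =ᵐ[μΩ d] fun x => p.fst x * pderiv j ψ x + q.fst x * pderiv j ψ x := by
      filter_upwards [Lp.coeFn_add p.fst q.fst] with x hx
      rw [hx, Pi.add_apply, add_mul]
    have h2 : (fun x => ((p.snd j + q.snd j : L2 d) : (Fin d → ℝ) → ℂ) x * ψ x)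
        =ᵐ[μΩ d] fun x => p.snd j x * ψ x + q.snd j x * ψ x := by
      filter_upwards [Lp.coeFn_add (p.snd j) (q.snd j)] with x hx
      rw [hx, Pi.add_apply, add_mul]
    have h3 := integral_congr_ae h1
    have h4 := integral_congr_ae h2
    have hc := continuous_pderiv hψ j
    rw [integral_add (integrable_mul_continuous _ hc) (integrable_mul_continuous _ hc)] at h3
    rw [integral_add (integrable_mul_continuous _ hψ.continuous)
      (integrable_mul_continuous _ hψ.continuous)] at h4
    simp only [WithLp.add_fst, WithLp.add_snd, PiLp.add_apply]
    rw [h3, h4, hp ψ hψ hper j, hq ψ hψ hper j]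
    ring
  smul_mem' := by
    intro c p hp ψ hψ hper j
    have h1 : (fun x => ((c • p.fst : L2 d) : (Fin d → ℝ) → ℂ) x * pderiv j ψ x)
        =ᵐ[μΩ d] fun x => c * (p.fst x * pderiv j ψ x) := by
      filter_upwards [Lp.coeFn_smul c p.fst] with x hx
      rw [hx, Pi.smul_apply, smul_eq_mul, mul_assoc]
    have h2 : (fun x => ((c • p.snd j : L2 d) : (Fin d → ℝ) → ℂ) x * ψ x)
        =ᵐ[μΩ d] fun x => c * (p.snd j x * ψ x) := by
      filter_upwards [Lp.coeFn_smul c (p.snd j)] with x hx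
      rw [hx, Pi.smul_apply, smul_eq_mul, mul_assoc]
    have h3 := integral_congr_ae h1
    have h4 := integral_congr_ae h2
    rw [integral_const_mul] at h3 h4
    simp only [WithLp.smul_fst, WithLp.smul_snd, PiLp.smul_apply]
    rw [h3, h4, hp ψ hψ hper j]
    ring

/-- The underlying `L²` function of `v ∈ H¹_p(Ω)`. -/
def toFn {d : ℕ} (v : H1p d) : L2 d := (v : L2Pair d).fst

/-- The weak gradient `∇v` of `v ∈ H¹_p(Ω)`. -/
def grad {d : ℕ} (v : H1p d) (j : Fin d) : L2 d := (v : L2Pair d).snd j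

/-- The dual `H⁻¹_p(Ω)`: continuous conjugate-linear forms on `H¹_p(Ω)`, with the dual norm. -/
abbrev Hm1p (d : ℕ) := H1p d →L⋆[ℂ] ℂ

/-! ### The Fourier basis -/

/-- The trigonometric function `φ_k(x) = (2π)^(-d/2) exp(i k·x)`. -/
def phiFn {d : ℕ} (k : Fin d → ℤ) (x : Fin d → ℝ) : ℂ :=
  (((2 * Real.pi) ^ (-(d : ℝ) / 2) : ℝ) : ℂ) *
    Complex.exp (Complex.I * ∑ j, ((k j : ℝ) : ℂ) * ((x j : ℝ) : ℂ))

theorem contDiff_phiFn {d : ℕ} (k : Fin d → ℤ) : ContDiff ℝ ∞ (phiFn k) := by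
  unfold phiFn
  refine contDiff_const.mul (ContDiff.cexp (contDiff_const.mul (ContDiff.sum fun j _ => ?_)))
  exact contDiff_const.mul (Complex.ofRealCLM.contDiff.comp (contDiff_apply ℝ ℝ j))

theorem isPeriodic_phiFn {d : ℕ} (k : Fin d → ℤ) : IsPeriodic (phiFn k) := by
  intro j x
  unfold phiFn
  congr 1
  have h : Complex.I * ∑ i, ((k i : ℝ) : ℂ) *
      (((x + Pi.single j (2 * Real.pi) : Fin d → ℝ) i : ℝ) : ℂ) =
      Complex.I * ∑ i, ((k i : ℝ) : ℂ) * ((x i : ℝ) : ℂ) +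
        (k j) * (2 * Real.pi * Complex.I) := by
    have h2 : ∑ i, ((k i : ℝ) : ℂ) * (((Pi.single j (2 * Real.pi) : Fin d → ℝ) i : ℝ) : ℂ) =
        ((k j : ℝ) : ℂ) * ((2 * Real.pi : ℝ) : ℂ) := by
      rw [Finset.sum_eq_single j]
      · simp
      · intro b _ hb
        simp [Pi.single_eq_of_ne hb]
      · simp
    simp only [Pi.add_apply, Complex.ofReal_add, mul_add, Finset.sum_add_distrib]
    rw [h2]
    push_cast
    ring
  rw [h, Complex.exp_add, Complex.exp_int_mul_two_pi_mul_I, mul_one]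

theorem pderiv_phiFn {d : ℕ} (k : Fin d → ℤ) (j : Fin d) (x : Fin d → ℝ) :
    pderiv j (phiFn k) x = Complex.I * ((k j : ℝ) : ℂ) * phiFn k x := by
  have hlin : HasFDerivAt
      (fun y : Fin d → ℝ => Complex.I * ∑ i, ((k i : ℝ) : ℂ) * ((y i : ℝ) : ℂ))
      (Complex.I • ∑ i, ((k i : ℝ) : ℂ) • (Complex.ofRealCLM.comp
        (ContinuousLinearMap.proj (R := ℝ) (φ := fun _ : Fin d => ℝ) i))) x := by
    refine HasFDerivAt.const_mul (HasFDerivAt.fun_sum fun i _ => HasFDerivAt.const_mul ?_ _) _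
    exact (Complex.ofRealCLM.comp
      (ContinuousLinearMap.proj (R := ℝ) (φ := fun _ : Fin d => ℝ) i)).hasFDerivAt
  have h := (hlin.cexp).const_mul (((2 * Real.pi) ^ (-(d : ℝ) / 2) : ℝ) : ℂ)
  have h2 : fderiv ℝ (phiFn k) x = _ := h.fderiv
  rw [pderiv, h2]
  have h3 : ∑ i, ((k i : ℝ) : ℂ) * (((Pi.single j 1 : Fin d → ℝ) i : ℝ) : ℂ) =
      ((k j : ℝ) : ℂ) := by
    rw [Finset.sum_eq_single j]
    · simp
    · intro b _ hb
      simp [Pi.single_eq_of_ne hb]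
    · simp
  simp only [_root_.smul_apply, _root_.sum_apply, smul_eq_mul,
    ContinuousLinearMap.comp_apply, ContinuousLinearMap.proj_apply, Complex.ofRealCLM_apply]
  rw [h3, phiFn]
  ring

/-- The integral over `Ω` of a partial derivative of a periodic smooth function vanishes. -/
theorem integral_pderiv_eq_zero {d : ℕ} {F : (Fin d → ℝ) → ℂ} (hF : ContDiff ℝ ∞ F)
    (hper : IsPeriodic F) (j : Fin d) : ∫ x in Ω d, pderiv j F x = 0 := by
  cases d with
  | zero => exact j.elim0
  | succ n =>
    have hle : (fun _ : Fin (n + 1) => (0 : ℝ)) ≤ fun _ => 2 * Real.pi :=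
      fun _ => by positivity
    have hcont := continuous_pderiv hF j
    have hd : ∀ x, HasFDerivAt F (fderiv ℝ F x) x := fun x =>
      (hF.differentiable (by simp) x).hasFDerivAt
    have hsum : ∀ x, ∑ i, (if i = j then fderiv ℝ F x else 0) (Pi.single i 1) = pderiv j F x := by
      intro x
      rw [Finset.sum_eq_single j]
      · simp [pderiv]
      · intro b _ hb
        simp [hb]
      · simp
    have key := integral_divergence_of_hasFDerivAt_off_countable' (E := ℂ)
      (fun _ : Fin (n + 1) => (0 : ℝ)) (fun _ => 2 * Real.pi) hle
      (fun i x => if i = j then F x else 0)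
      (fun i x => if i = j then fderiv ℝ F x else 0) ∅ countable_empty
      (by
        intro i
        by_cases h : i = j
        · simpa [h] using hF.continuous.continuousOn
        · simpa [h] using continuousOn_const)
      (by
        intro x _ i
        by_cases h : i = j
        · simpa [h] using hd x
        · simpa [h] using hasFDerivAt_const (0 : ℂ) x)
      (by
        simp only [hsum]
        exact hcont.continuousOn.integrableOn_compact isCompact_Icc)
    simp only [hsum] at key
    have hΩ : ∫ x in Ω (n + 1), pderiv j F x =
        ∫ x in Icc (fun _ => 0) (fun _ => 2 * Real.pi), pderiv j F x := by
      apply setIntegral_congr_set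
      rw [volume_pi]
      exact Measure.univ_pi_Ioo_ae_eq_Icc
    rw [hΩ, key]
    refine Finset.sum_eq_zero fun i _ => ?_
    by_cases h : i = j
    · subst h
      simp only [if_true]
      rw [sub_eq_zero]
      congr 1
      funext y
      rw [← hper i (i.insertNth 0 y)]
      congr 1
      funext l
      refine Fin.succAboveCases i ?_ (fun m => ?_) l
      · simp
      · simp
    · simp [h]

/-- `φ_k` as an element of `L²(Ω)`. -/
def phiL2 {d : ℕ} (k : Fin d → ℤ) : L2 d :=
  (memLp_of_continuous (contDiff_phiFn k).continuous).toLp (phiFn k)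

/-- The pair `(φ_k, ∇φ_k)`, where `∂_j φ_k = i k_j φ_k`. -/
def phiPair {d : ℕ} (k : Fin d → ℤ) : L2Pair d :=
  WithLp.toLp 2 (phiL2 k, WithLp.toLp 2 fun j => (Complex.I * ((k j : ℝ) : ℂ)) • phiL2 k)

theorem phiPair_mem {d : ℕ} (k : Fin d → ℤ) : phiPair k ∈ H1p d := by
  intro ψ hψ hper j
  have h0 : (phiL2 k : (Fin d → ℝ) → ℂ) =ᵐ[μΩ d] phiFn k := MemLp.coeFn_toLp _
  have h1 : (fun x => (phiL2 k : (Fin d → ℝ) → ℂ) x * pderiv j ψ x)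
      =ᵐ[μΩ d] fun x => phiFn k x * pderiv j ψ x := by
    filter_upwards [h0] with x hx
    rw [hx]
  have h2 : (fun x => (((Complex.I * ((k j : ℝ) : ℂ)) • phiL2 k : L2 d) : (Fin d → ℝ) → ℂ) x * ψ x)
      =ᵐ[μΩ d] fun x => pderiv j (phiFn k) x * ψ x := by
    filter_upwards [h0, Lp.coeFn_smul (Complex.I * ((k j : ℝ) : ℂ)) (phiL2 k)] with x hx hx2
    rw [hx2, Pi.smul_apply, smul_eq_mul, hx, pderiv_phiFn]
  have hc := contDiff_phiFn k
  have hprod : ∀ x, pderiv j (fun y => phiFn k y * ψ y) x =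
      phiFn k x * pderiv j ψ x + pderiv j (phiFn k) x * ψ x := by
    intro x
    have := ((hc.differentiable (by simp) x).hasFDerivAt.mul
      (hψ.differentiable (by simp) x).hasFDerivAt).fderiv
    have h : fderiv ℝ (fun y => phiFn k y * ψ y) x = _ := this
    rw [pderiv, h]
    simp [pderiv, mul_comm]
  have hz := integral_pderiv_eq_zero (hc.mul hψ)
    (fun i x => by simp only [isPeriodic_phiFn k i x, hper i x]) j
  simp only [hprod] at hz
  have i1 : Integrable (fun x => phiFn k x * pderiv j ψ x) (μΩ d) :=
    (memLp_of_continuous hc.continuous).integrable_mul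
      (memLp_of_continuous (continuous_pderiv hψ j))
  have i2 : Integrable (fun x => pderiv j (phiFn k) x * ψ x) (μΩ d) :=
    (memLp_of_continuous (continuous_pderiv hc j)).integrable_mul
      (memLp_of_continuous hψ.continuous)
  rw [integral_add i1 i2] at hz
  change ∫ x in Ω d, (phiL2 k : (Fin d → ℝ) → ℂ) x * pderiv j ψ x =
    - ∫ x in Ω d, (((Complex.I * ((k j : ℝ) : ℂ)) • phiL2 k : L2 d) : (Fin d → ℝ) → ℂ) x * ψ x
  rw [integral_congr_ae h1, integral_congr_ae h2]
  exact eq_neg_of_add_eq_zero_left hz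

/-- `φ_k` as an element of `H¹_p(Ω)`. -/
def phi {d : ℕ} (k : Fin d → ℤ) : H1p d := ⟨phiPair k, phiPair_mem k⟩

/-- The Fourier coefficient `v̂_k = (v, φ_k)` of `v ∈ H¹_p(Ω)`. -/
def coeffV {d : ℕ} (v : H1p d) (k : Fin d → ℤ) : ℂ :=
  ∫ x in Ω d, toFn v x * (starRingEnd ℂ) (phiFn k x)

/-- The Fourier coefficient `f̂_k = ⟨f, φ_k⟩` of `f ∈ H⁻¹_p(Ω)`. -/
def coeffV' {d : ℕ} (f : Hm1p d) (k : Fin d → ℤ) : ℂ := f (phi k)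

/-- A function `w ∈ L²(Ω)` as the form `v ↦ (w, v) = ∫_Ω w v̄` in `H⁻¹_p(Ω)`. -/
def formOfL2 {d : ℕ} (w : L2 d) : Hm1p d :=
  LinearMap.mkContinuous
    { toFun := fun v => inner ℂ (toFn v) w
      map_add' := fun u v => by
        rw [← inner_add_left]
        rfl
      map_smul' := fun c v => by
        rw [smul_eq_mul, ← inner_smul_left]
        rfl }
    ‖w‖ (fun v => by
      have h : ‖toFn v‖ ≤ ‖v‖ := WithLp.norm_fst_le _ (v : L2Pair d)
      calc ‖inner ℂ (toFn v) w‖ ≤ ‖toFn v‖ * ‖w‖ := norm_inner_le_norm _ _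
        _ ≤ ‖v‖ * ‖w‖ := by gcongr
        _ = ‖w‖ * ‖v‖ := mul_comm _ _)

theorem formOfL2_apply {d : ℕ} (w : L2 d) (v : H1p d) :
    formOfL2 w v = ∫ x in Ω d, w x * (starRingEnd ℂ) (toFn v x) := by
  change inner ℂ (toFn v) w = _
  rw [L2.inner_def]
  rfl

/-- The projection `P_Λ v = ∑ k ∈ Λ, v̂_k φ_k` of `v ∈ H¹_p(Ω)`. -/
def projV {d : ℕ} (Λ : Finset (Fin d → ℤ)) (v : H1p d) : H1p d :=
  ∑ k ∈ Λ, coeffV v k • phi k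

/-- The projection `P_Λ f = ∑ k ∈ Λ, f̂_k φ_k` of `f ∈ H⁻¹_p(Ω)`. -/
def projV' {d : ℕ} (Λ : Finset (Fin d → ℤ)) (f : Hm1p d) : Hm1p d :=
  ∑ k ∈ Λ, coeffV' f k • formOfL2 (phiL2 k)

/-! ### Best `N`-term approximation and the algebraic sparsity classes -/

/-- The best `N`-term approximation error `E_N(v)` in `H¹_p(Ω)`. -/
def bestErrV {d : ℕ} (N : ℕ) (v : H1p d) : ℝ :=
  ⨅ Λ : {Λ : Finset (Fin d → ℤ) // Λ.card = N}, ‖v - projV Λ.1 v‖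

/-- The best `N`-term approximation error `E_N(f)` in `H⁻¹_p(Ω)`. -/
def bestErrV' {d : ℕ} (N : ℕ) (f : Hm1p d) : ℝ :=
  ⨅ Λ : {Λ : Finset (Fin d → ℤ) // Λ.card = N}, ‖f - projV' Λ.1 f‖

/-- `‖v‖ + sup_{N ≥ 1} E_N(v) N^(s/d)`, with values in `[0, ∞]`, for `v ∈ H¹_p(Ω)`. -/
def ABnormV {d : ℕ} (s : ℝ) (v : H1p d) : ℝ≥0∞ :=
  ENNReal.ofReal ‖v‖ +
    ⨆ (N : ℕ) (_ : 1 ≤ N), ENNReal.ofReal (bestErrV N v * (N : ℝ) ^ (s / (d : ℝ)))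

/-- `‖f‖ + sup_{N ≥ 1} E_N(f) N^(s/d)`, with values in `[0, ∞]`, for `f ∈ H⁻¹_p(Ω)`. -/
def ABnormV' {d : ℕ} (s : ℝ) (f : Hm1p d) : ℝ≥0∞ :=
  ENNReal.ofReal ‖f‖ +
    ⨆ (N : ℕ) (_ : 1 ≤ N), ENNReal.ofReal (bestErrV' N f * (N : ℝ) ^ (s / (d : ℝ)))

/-- The algebraic sparsity class `𝒜_B^s` in `H¹_p(Ω)`. -/
def ABclassV (d : ℕ) (s : ℝ) : Set (H1p d) := {v | ABnormV s v < ⊤}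

/-- The algebraic sparsity class `𝒜_B^s` in `H⁻¹_p(Ω)`. -/
def ABclassV' (d : ℕ) (s : ℝ) : Set (Hm1p d) := {f | ABnormV' s f < ⊤}

/-! ### The elliptic operator, the Galerkin problem and the residual -/

/-- Real coefficients `ν`, `σ` of the operator `Lu = -∇·(ν∇u) + σu`, measurable and bounded
above and below by positive constants on `Ω`. -/
structure Coefficients (d : ℕ) where
  ν : (Fin d → ℝ) → ℝ
  σ : (Fin d → ℝ) → ℝ
  measurable_ν : AEStronglyMeasurable ν (μΩ d)
  measurable_σ : AEStronglyMeasurable σ (μΩ d)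
  bounds_ν : ∃ lo hi : ℝ, 0 < lo ∧ ∀ x ∈ Ω d, lo ≤ ν x ∧ ν x ≤ hi
  bounds_σ : ∃ lo hi : ℝ, 0 < lo ∧ ∀ x ∈ Ω d, lo ≤ σ x ∧ σ x ≤ hi

/-- The sesquilinear form `a(u, v) = ∫_Ω ν ∇u · ∇v̄ + ∫_Ω σ u v̄`. -/
def Coefficients.a {d : ℕ} (P : Coefficients d) (u v : H1p d) : ℂ :=
  (∫ x in Ω d, ∑ j, (P.ν x : ℂ) * (grad u j x * (starRingEnd ℂ) (grad v j x))) +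
    ∫ x in Ω d, (P.σ x : ℂ) * (toFn u x * (starRingEnd ℂ) (toFn v x))

/-- Multiplication of `L²(Ω)` by a bounded measurable function. -/
theorem exists_mulL2 {d : ℕ} {m : (Fin d → ℝ) → ℝ} (hm : AEStronglyMeasurable m (μΩ d))
    (hb : ∃ lo hi : ℝ, 0 < lo ∧ ∀ x ∈ Ω d, lo ≤ m x ∧ m x ≤ hi) :
    ∃ T : L2 d →L[ℂ] L2 d, ∀ f g : L2 d,
      Integrable (fun x => (m x : ℂ) * (f x * (starRingEnd ℂ) (g x))) (μΩ d) ∧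
      inner ℂ g (T f) = ∫ x in Ω d, (m x : ℂ) * (f x * (starRingEnd ℂ) (g x)) := by
  obtain ⟨lo, hi, hlo, hb⟩ := hb
  have hmC : AEStronglyMeasurable (fun x => (m x : ℂ)) (μΩ d) :=
    Complex.continuous_ofReal.comp_aestronglyMeasurable hm
  have hbd : ∀ᵐ x ∂(μΩ d), ‖(m x : ℂ)‖ ≤ hi := by
    filter_upwards [ae_restrict_mem (measurableSet_Ω d)] with x hx
    rw [Complex.norm_real, Real.norm_eq_abs, abs_of_pos (hlo.trans_le (hb x hx).1)]
    exact (hb x hx).2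
  have hmem : ∀ f : L2 d, MemLp (fun x => (m x : ℂ) * f x) 2 (μΩ d) := by
    intro f
    refine MemLp.of_le_mul (c := hi) (Lp.memLp f) (hmC.mul (Lp.aestronglyMeasurable f)) ?_
    filter_upwards [hbd] with x hx
    rw [norm_mul]
    exact mul_le_mul_of_nonneg_right hx (norm_nonneg _)
  let T₀ : L2 d →ₗ[ℂ] L2 d :=
    { toFun := fun f => (hmem f).toLp _
      map_add' := fun f g => by
        rw [← MemLp.toLp_add]
        apply MemLp.toLp_congr
        filter_upwards [Lp.coeFn_add f g] with x hx
        rw [hx, Pi.add_apply, Pi.add_apply, mul_add]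
      map_smul' := fun c f => by
        rw [RingHom.id_apply, ← MemLp.toLp_const_smul]
        apply MemLp.toLp_congr
        filter_upwards [Lp.coeFn_smul c f] with x hx
        rw [hx, Pi.smul_apply, Pi.smul_apply, smul_eq_mul, smul_eq_mul]
        ring }
  have hT : ∀ f : L2 d, (T₀ f : (Fin d → ℝ) → ℂ) =ᵐ[μΩ d] fun x => (m x : ℂ) * f x :=
    fun f => (hmem f).coeFn_toLp
  refine ⟨T₀.mkContinuous hi fun f => ?_, fun f g => ⟨?_, ?_⟩⟩
  · refine Lp.norm_le_mul_norm_of_ae_le_mul ?_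
    filter_upwards [hT f, hbd] with x hx hx2
    rw [hx, norm_mul]
    exact mul_le_mul_of_nonneg_right hx2 (norm_nonneg _)
  · have hg : MemLp (fun x => (starRingEnd ℂ) (g x)) 2 (μΩ d) := (Lp.memLp g).star
    refine ((hmem f).integrable_mul hg).congr ?_
    filter_upwards with x
    simp [mul_assoc]
  · rw [L2.inner_def]
    refine integral_congr_ae ?_
    filter_upwards [hT f] with x hx
    change inner ℂ (g x) ((T₀ f : (Fin d → ℝ) → ℂ) x) = _
    rw [hx]
    simp [mul_assoc]

theorem Coefficients.exists_L {d : ℕ} (P : Coefficients d) :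
    ∃ L : H1p d →L[ℂ] Hm1p d, ∀ u v : H1p d, L u v = P.a u v := by
  obtain ⟨Tν, hν⟩ := exists_mulL2 P.measurable_ν P.bounds_ν
  obtain ⟨Tσ, hσ⟩ := exists_mulL2 P.measurable_σ P.bounds_σ
  have ha : ∀ u v : H1p d, P.a u v =
      ∑ j, inner ℂ (grad v j) (Tν (grad u j)) + inner ℂ (toFn v) (Tσ (toFn u)) := by
    intro u v
    rw [Coefficients.a, integral_finsetSum _ fun j _ => (hν (grad u j) (grad v j)).1]
    rw [(hσ _ _).2]
    congr 1
    exact Finset.sum_congr rfl fun j _ => ((hν _ _).2).symm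
  have hadd : ∀ u v : H1p d, toFn (u + v) = toFn u + toFn v := fun _ _ => rfl
  have hsmul : ∀ (c : ℂ) (v : H1p d), toFn (c • v) = c • toFn v := fun _ _ => rfl
  have gadd : ∀ (u v : H1p d) j, grad (u + v) j = grad u j + grad v j := fun _ _ _ => rfl
  have gsmul : ∀ (c : ℂ) (v : H1p d) j, grad (c • v) j = c • grad v j := fun _ _ _ => rfl
  have n0 : ∀ v : H1p d, ‖toFn v‖ ≤ ‖v‖ := fun v => WithLp.norm_fst_le _ (v : L2Pair d)
  have n1 : ∀ (v : H1p d) j, ‖grad v j‖ ≤ ‖v‖ := fun v j =>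
    (PiLp.norm_apply_le (v : L2Pair d).snd j).trans (WithLp.norm_snd_le _ (v : L2Pair d))
  let B : H1p d →ₗ[ℂ] H1p d →ₛₗ[starRingEnd ℂ] ℂ :=
    LinearMap.mk₂'ₛₗ (RingHom.id ℂ) (starRingEnd ℂ) (fun u v => P.a u v)
      (by
        intro u u' v
        simp only [ha, hadd, gadd, map_add, inner_add_right, Finset.sum_add_distrib]
        ring)
      (by
        intro c u v
        simp only [ha, hsmul, gsmul, map_smul, inner_smul_right, ← Finset.mul_sum]
        simp [mul_add])
      (by
        intro u v v'
        simp only [ha, hadd, gadd, inner_add_left, Finset.sum_add_distrib]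
        ring)
      (by
        intro c u v
        simp only [ha, hsmul, gsmul, inner_smul_left, ← Finset.mul_sum]
        simp [mul_add])
  refine ⟨B.mkContinuous₂ (d * ‖Tν‖ + ‖Tσ‖) fun u v => ?_, fun u v => rfl⟩
  change ‖P.a u v‖ ≤ _
  rw [ha]
  have e1 : ∀ (T : L2 d →L[ℂ] L2 d) (f g : L2 d), ‖f‖ ≤ ‖u‖ → ‖g‖ ≤ ‖v‖ →
      ‖inner ℂ g (T f)‖ ≤ ‖T‖ * ‖u‖ * ‖v‖ := by
    intro T f g hf hg
    calc ‖inner ℂ g (T f)‖ ≤ ‖g‖ * ‖T f‖ := norm_inner_le_norm _ _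
      _ ≤ ‖v‖ * (‖T‖ * ‖u‖) := by
          gcongr
          exact (T.le_opNorm f).trans (by gcongr)
      _ = ‖T‖ * ‖u‖ * ‖v‖ := by ring
  calc _ ≤ ‖∑ j, inner ℂ (grad v j) (Tν (grad u j))‖ + ‖inner ℂ (toFn v) (Tσ (toFn u))‖ :=
        norm_add_le _ _
    _ ≤ (∑ _j : Fin d, ‖Tν‖ * ‖u‖ * ‖v‖) + ‖Tσ‖ * ‖u‖ * ‖v‖ := by
        gcongr
        · exact (norm_sum_le _ _).trans
            (Finset.sum_le_sum fun j _ => e1 _ _ _ (n1 u j) (n1 v j))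
        · exact e1 _ _ _ (n0 u) (n0 v)
    _ = (d * ‖Tν‖ + ‖Tσ‖) * ‖u‖ * ‖v‖ := by
        simp
        ring

/-- The elliptic operator `L : H¹_p(Ω) → H⁻¹_p(Ω)`, determined by `⟨Lu, v⟩ = a(u, v)`. -/
def Coefficients.L {d : ℕ} (P : Coefficients d) : H1p d →L[ℂ] Hm1p d :=
  P.exists_L.choose

theorem Coefficients.L_apply {d : ℕ} (P : Coefficients d) (u v : H1p d) : P.L u v = P.a u v :=
  P.exists_L.choose_spec u v

/-- `u ∈ H¹_p(Ω)` is the weak solution of `Lu = f`. -/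
def Coefficients.IsWeakSolution {d : ℕ} (P : Coefficients d) (f : Hm1p d) (u : H1p d) : Prop :=
  ∀ v : H1p d, P.a u v = f v

/-- The finite dimensional space `V_Λ = span {φ_k : k ∈ Λ}`. -/
def VΛ {d : ℕ} (Λ : Finset (Fin d → ℤ)) : Submodule ℂ (H1p d) :=
  Submodule.span ℂ (phi '' (Λ : Set (Fin d → ℤ)))

/-- `w` is the Galerkin approximation `u_Λ` in `V_Λ` of the weak solution of `Lu = f`. -/
def Coefficients.IsGalerkinSolution {d : ℕ} (P : Coefficients d) (f : Hm1p d)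
    (Λ : Finset (Fin d → ℤ)) (w : H1p d) : Prop :=
  w ∈ VΛ Λ ∧ ∀ v ∈ VΛ Λ, P.a w v = f v

/-- The residual `r(w) = f - Lw ∈ H⁻¹_p(Ω)`. -/
def Coefficients.residual {d : ℕ} (P : Coefficients d) (f : Hm1p d) (w : H1p d) : Hm1p d :=
  f - P.L w

/-! ### The stiffness matrix and its off-diagonal decay -/

/-- The Euclidean norm `|k|` of a multi-index. -/
def euclNorm {d : ℕ} (k : Fin d → ℤ) : ℝ := Real.sqrt (∑ j, ((k j : ℝ)) ^ 2)

/-- The normalization factor `c_k = (1 + |k|²)^(1/2)`. -/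
def cfac {d : ℕ} (k : Fin d → ℤ) : ℝ := Real.sqrt (1 + euclNorm k ^ 2)

/-- The stiffness matrix `a_{ℓ,k} = a(φ_k, φ_ℓ) / (c_ℓ c_k)`. -/
def Coefficients.stiffness {d : ℕ} (P : Coefficients d) :
    Matrix (Fin d → ℤ) (Fin d → ℤ) ℂ :=
  fun l k => P.a (phi k) (phi l) / ((cfac l * cfac k : ℝ) : ℂ)

/-- The class `𝒟_a(η)` of matrices with algebraic off-diagonal decay of order `η`. -/
def AlgDecay {d : ℕ} (η : ℝ) (A : Matrix (Fin d → ℤ) (Fin d → ℤ) ℂ) : Prop :=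
  ∃ c : ℝ, 0 < c ∧ ∀ l k : Fin d → ℤ, ‖A l k‖ ≤ c * (1 + euclNorm (l - k)) ^ (-η)

end

end FourierGalerkin

namespace FourierGalerkin

noncomputable section

/-! ### Lattice sums -/

/-! The functions `φ_k / c_k` form an orthonormal basis of `H¹_p(Ω)` (`phiBasis`). Composing `L`
with the inverse Riesz map gives an operator `A` (`Coefficients.op`) whose matrix in this basis is
the stiffness matrix. The Riesz map is an isometry that commutes with the projections `P_Λ`, so the
residual has the same sparsity norm as `A u - A u_Λ`, and everything can be done for a bounded
coercive operator on a Hilbert space.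

The decay of the matrix enters only through approximation in operator norm: cutting `A` at distance
`r` from the diagonal costs `O(r ^ (-δ))` for each `δ < η_L - d` (`exists_bandApprox_of_decay`). An
operator approximable in this way with `δ > s` maps sparse vectors of order `t = s / d` to sparse
vectors (`exists_sparse_map`): the vector is split into dyadic layers, and the layers with few terms
are treated with the wide bands.

It remains to see that `u_Λ` is sparse uniformly in `Λ`. With `G = 1 - τ A` a contraction, `P` the
truncation to `Λ` and `T = P G P`, the Galerkin equations say `(1 - T) u_Λ = τ P A u`. The norm of
`T` and its banded approximations are bounded independently of `Λ`. A Neumann series, cut at a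
suitable length and with `T` replaced by a banded operator, shows that `(1 - T)⁻¹` has banded
approximations of every order `δ' < δ` (`exists_bandApprox_inverse`). The strict inequality `s < η_L
- d` leaves room for this loss. Hence `u_Λ`, and then `A u - A u_Λ`, is sparse
(`exists_sparse_residual`). -/

theorem summable_one_add_abs_int_rpow {q : ℝ} (hq : 1 < q) :
    Summable fun n : ℤ => (1 + |(n : ℝ)|) ^ (-q) := by
  -- The comparison with `|n| ^ (-q)` fails at `n = 0`, where the real power takes its default
  -- value; the indicator of `0` supplies that term.
  have h := (Real.summable_abs_int_rpow hq).add
    (hasSum_ite_eq (0 : ℤ) (1 : ℝ)).summable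
  refine Summable.of_nonneg_of_le (fun n => by positivity) (fun n => ?_) h
  by_cases hn : n = 0
  · subst hn
    have : (0 : ℝ) ≤ |((0 : ℤ) : ℝ)| ^ (-q) := by positivity
    simpa using this
  · have h0 : 0 < |(n : ℝ)| := abs_pos.mpr (by exact_mod_cast hn)
    simpa [hn] using Real.rpow_le_rpow_of_nonpos h0 (by linarith) (by linarith : -q ≤ 0)

/-- Distributing the exponent equally over the coordinates bounds each term by a product of
one-dimensional terms of exponent `p / d > 1`. -/
theorem summable_one_add_norm_rpow {d : ℕ} (hd : 1 ≤ d) {p : ℝ} (hp : (d : ℝ) < p) :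
    Summable fun m : Fin d → ℤ => (1 + ‖m‖) ^ (-p) := by
  classical
  have hd0 : (0 : ℝ) < d := by exact_mod_cast hd
  have hq : 1 < p / d := by rwa [one_lt_div hd0]
  have hs := summable_one_add_abs_int_rpow hq
  set q := p / d with hqdef
  have hpt : ∀ m : Fin d → ℤ, (1 + ‖m‖) ^ (-p) ≤ ∏ i, (1 + |((m i : ℤ) : ℝ)|) ^ (-q) := by
    intro m
    have h1 : (1 + ‖m‖) ^ (-p) = ∏ _i : Fin d, (1 + ‖m‖) ^ (-q) := by
      rw [Finset.prod_const, Finset.card_univ, Fintype.card_fin, ← Real.rpow_natCast,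
        ← Real.rpow_mul (by positivity)]
      congr 1
      rw [hqdef]
      field_simp
    rw [h1]
    refine Finset.prod_le_prod (fun i _ => by positivity) fun i _ => ?_
    refine Real.rpow_le_rpow_of_nonpos (by positivity) ?_ (by linarith)
    have := norm_le_pi_norm m i
    rw [Int.norm_eq_abs] at this
    linarith
  refine summable_of_sum_le (c := ∏ _i : Fin d, ∑' n : ℤ, (1 + |(n : ℝ)|) ^ (-q))
    (fun m => by positivity) fun s => ?_
  calc ∑ m ∈ s, (1 + ‖m‖) ^ (-p) ≤ ∑ m ∈ s, ∏ i, (1 + |((m i : ℤ) : ℝ)|) ^ (-q) :=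
        Finset.sum_le_sum fun m _ => hpt m
    -- The finite set is enlarged to the box spanned by its coordinate projections, where the sum
    -- factors.
    _ ≤ ∑ m ∈ Fintype.piFinset (fun i => s.image (· i)),
          ∏ i, (1 + |((m i : ℤ) : ℝ)|) ^ (-q) := by
        refine Finset.sum_le_sum_of_subset_of_nonneg (fun m hm => ?_) fun _ _ _ => by positivity
        exact Fintype.mem_piFinset.mpr fun i => Finset.mem_image_of_mem _ hm
    _ = ∏ i, ∑ n ∈ s.image (fun m => m i), (1 + |((n : ℤ) : ℝ)|) ^ (-q) := by
        rw [Finset.prod_univ_sum]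
    _ ≤ _ := Finset.prod_le_prod (fun i _ => Finset.sum_nonneg fun _ _ => by positivity)
        fun i _ => hs.sum_le_tsum _ fun _ _ => by positivity

/-- The lattice points of the ball of radius `r` for the maximum norm. -/
def latticeBall (d : ℕ) (r : ℝ) : Finset (Fin d → ℤ) :=
  Finset.Icc (fun _ => -⌊r⌋) fun _ => ⌊r⌋

theorem mem_latticeBall {d : ℕ} {r : ℝ} (hr : 0 ≤ r) (m : Fin d → ℤ) :
    m ∈ latticeBall d r ↔ ‖m‖ ≤ r := by
  rw [latticeBall, Finset.mem_Icc, pi_norm_le_iff_of_nonneg hr, Pi.le_def, Pi.le_def,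
    ← forall_and]
  refine forall_congr' fun i => ?_
  rw [← abs_le, Int.le_floor, Int.norm_eq_abs, Int.cast_abs]

theorem card_latticeBall_le {d : ℕ} {r : ℝ} (hr : 1 ≤ r) :
    ((latticeBall d r).card : ℝ) ≤ (3 * r) ^ d := by
  have h0 : (0 : ℤ) ≤ ⌊r⌋ := Int.floor_nonneg.mpr (by linarith)
  rw [latticeBall, Pi.card_Icc]
  simp only [Int.card_Icc, Finset.prod_const, Finset.card_univ, Fintype.card_fin, Nat.cast_pow]
  gcongr
  have h1 : (((⌊r⌋ + 1 - -⌊r⌋).toNat : ℤ) : ℝ) = 2 * (⌊r⌋ : ℝ) + 1 := by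
    rw [Int.toNat_of_nonneg (by omega)]
    push_cast
    ring
  have h2 := Int.floor_le r
  rw [Int.cast_natCast] at h1
  rw [h1]
  linarith

/-! ### Banded operators -/

section Banded

variable {d : ℕ} {E : Type*} [NormedAddCommGroup E] [InnerProductSpace ℂ E]

/-- The coordinates of `x` outside `Λ` vanish. -/
def SuppIn (b : HilbertBasis (Fin d → ℤ) ℂ E) (Λ : Finset (Fin d → ℤ)) (x : E) : Prop :=
  ∀ k, b.repr x k ≠ 0 → k ∈ Λ

/-- The matrix of `S` vanishes at distance greater than `r` from the diagonal. -/
def Banded (b : HilbertBasis (Fin d → ℤ) ℂ E) (r : ℝ) (S : E →L[ℂ] E) : Prop :=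
  ∀ x l, b.repr (S x) l ≠ 0 → ∃ k, b.repr x k ≠ 0 ∧ ‖l - k‖ ≤ r

/-- Banded operators approximate `T` at the algebraic rate `δ` in terms of the band width. -/
def BandApprox (b : HilbertBasis (Fin d → ℤ) ℂ E) (δ C : ℝ) (T : E →L[ℂ] E) : Prop :=
  ∀ r : ℝ, 1 ≤ r → ∃ S, Banded b r S ∧ ‖T - S‖ ≤ C * r ^ (-δ)

/-- The norm of `x` and its weighted `N`-term approximation errors are bounded by `M`. -/
def Sparse (b : HilbertBasis (Fin d → ℤ) ℂ E) (t M : ℝ) (x : E) : Prop :=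
  ‖x‖ ≤ M ∧ ∀ N : ℕ, 1 ≤ N → ∃ (Λ : Finset (Fin d → ℤ)) (y : E),
    Λ.card ≤ N ∧ SuppIn b Λ y ∧ ‖x - y‖ ≤ M * (N : ℝ) ^ (-t)

variable {b : HilbertBasis (Fin d → ℤ) ℂ E}

theorem suppIn_zero (Λ : Finset (Fin d → ℤ)) : SuppIn b Λ 0 := by
  intro k hk
  simp at hk

theorem SuppIn.sub [DecidableEq (Fin d → ℤ)] {Λ Λ' : Finset (Fin d → ℤ)} {x y : E}
    (hx : SuppIn b Λ x) (hy : SuppIn b Λ' y) : SuppIn b (Λ ∪ Λ') (x - y) := by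
  intro k hk
  rw [Finset.mem_union]
  by_contra! h
  apply hk
  rw [map_sub, lp.coeFn_sub, Pi.sub_apply, not_not.mp fun hn => h.1 (hx k hn),
    not_not.mp fun hn => h.2 (hy k hn), sub_zero]

theorem SuppIn.sum [DecidableEq (Fin d → ℤ)] {ι : Type*} (s : Finset ι)
    {Λ : ι → Finset (Fin d → ℤ)} {x : ι → E} (h : ∀ i ∈ s, SuppIn b (Λ i) (x i)) :
    SuppIn b (s.biUnion Λ) (∑ i ∈ s, x i) := by
  intro k hk
  rw [map_sum, lp.coeFn_sum, Finset.sum_apply] at hk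
  obtain ⟨i, hi, hik⟩ := Finset.exists_ne_zero_of_sum_ne_zero hk
  exact Finset.mem_biUnion.mpr ⟨i, hi, h i hi k hik⟩

/-- The new support lies in the Minkowski sum of `Λ` and the ball of radius `r`, which has at most
`(3 r) ^ d` points. -/
theorem Banded.exists_suppIn {r : ℝ} {S : E →L[ℂ] E} (hS : Banded b r S) (hr : 1 ≤ r)
    {Λ : Finset (Fin d → ℤ)} {x : E} (hx : SuppIn b Λ x) :
    ∃ Λ' : Finset (Fin d → ℤ), SuppIn b Λ' (S x) ∧ (Λ'.card : ℝ) ≤ (3 * r) ^ d * Λ.card := by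
  classical
  refine ⟨Finset.image₂ (· + ·) (latticeBall d r) Λ, fun l hl => ?_, ?_⟩
  · obtain ⟨k, hk, hlk⟩ := hS x l hl
    exact Finset.mem_image₂.mpr ⟨l - k, (mem_latticeBall (by linarith) _).mpr hlk, k, hx k hk,
      sub_add_cancel l k⟩
  · calc ((Finset.image₂ (· + ·) (latticeBall d r) Λ).card : ℝ)
        ≤ ((latticeBall d r).card * Λ.card : ℕ) := by
          exact_mod_cast Finset.card_image₂_le _ _ _
      _ ≤ (3 * r) ^ d * Λ.card := by
          push_cast
          gcongr
          exact card_latticeBall_le hr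

theorem Banded.zero (r : ℝ) : Banded b r 0 := by
  intro x l hl
  simp at hl

theorem Banded.one {r : ℝ} (hr : 0 ≤ r) : Banded b r 1 := by
  intro x l hl
  exact ⟨l, hl, by simpa using hr⟩

theorem Banded.mono {r r' : ℝ} {S : E →L[ℂ] E} (hS : Banded b r S) (h : r ≤ r') :
    Banded b r' S := by
  intro x l hl
  obtain ⟨k, hk, hlk⟩ := hS x l hl
  exact ⟨k, hk, hlk.trans h⟩

theorem Banded.add {r : ℝ} {S T : E →L[ℂ] E} (hS : Banded b r S) (hT : Banded b r T) :
    Banded b r (S + T) := by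
  intro x l hl
  by_cases h : b.repr (S x) l = 0
  · refine hT x l fun h' => hl ?_
    rw [add_apply, map_add, lp.coeFn_add, Pi.add_apply, h, h', add_zero]
  · exact hS x l h

theorem Banded.smul {r : ℝ} {S : E →L[ℂ] E} (c : ℂ) (hS : Banded b r S) :
    Banded b r (c • S) := by
  intro x l hl
  refine hS x l fun h => hl ?_
  rw [smul_apply, map_smul, lp.coeFn_smul, Pi.smul_apply, h, smul_zero]

theorem Banded.sub {r : ℝ} {S T : E →L[ℂ] E} (hS : Banded b r S) (hT : Banded b r T) :
    Banded b r (S - T) := by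
  have := hS.add (hT.smul (-1))
  rwa [neg_one_smul, ← sub_eq_add_neg] at this

theorem Banded.sum {ι : Type*} {r : ℝ} (s : Finset ι) {S : ι → E →L[ℂ] E}
    (h : ∀ i ∈ s, Banded b r (S i)) : Banded b r (∑ i ∈ s, S i) := by
  classical
  induction s using Finset.induction_on with
  | empty => exact Banded.zero r
  | insert i s hi ih =>
    rw [Finset.sum_insert hi]
    exact (h i (Finset.mem_insert_self i s)).add
      (ih fun j hj => h j (Finset.mem_insert_of_mem hj))

theorem Banded.mul {r r' : ℝ} {S T : E →L[ℂ] E} (hS : Banded b r S) (hT : Banded b r' T) :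
    Banded b (r + r') (S * T) := by
  intro x l hl
  obtain ⟨k, hk, hlk⟩ := hS (T x) l hl
  obtain ⟨m, hm, hkm⟩ := hT x k hk
  refine ⟨m, hm, ?_⟩
  calc ‖l - m‖ = ‖(l - k) + (k - m)‖ := by rw [sub_add_sub_cancel]
    _ ≤ r + r' := (norm_add_le _ _).trans (add_le_add hlk hkm)

theorem Banded.pow {r : ℝ} {S : E →L[ℂ] E} (hS : Banded b r S) (n : ℕ) :
    Banded b (n * r) (S ^ n) := by
  induction n with
  | zero => simpa using Banded.one (b := b) le_rfl
  | succ n ih =>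
    rw [pow_succ]
    refine (ih.mul hS).mono ?_
    push_cast
    linarith

/-! ### Operators with decaying matrices -/

/-- A weighted shift, that is, a matrix carried by the single side diagonal `l - k = m`. It serves
for the diagonals of `A` and, with `m = 0`, for coordinate projections. -/
theorem exists_diagonal (b : HilbertBasis (Fin d → ℤ) ℂ E) (m : Fin d → ℤ)
    (w : (Fin d → ℤ) → ℂ) {c : ℝ} (hc : 0 ≤ c) (hw : ∀ l, ‖w l‖ ≤ c) :
    ∃ D : E →L[ℂ] E, (∀ x l, b.repr (D x) l = w l * b.repr x (l - m)) ∧ ‖D‖ ≤ c := by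
  have hsum : ∀ f : lp (fun _ : Fin d → ℤ => ℂ) 2,
      Summable fun l => ‖f (l - m)‖ ^ (2 : ℝ) := fun f => by
    have := (lp.memℓp f).summable (by norm_num)
    simpa [Function.comp_def] using (Equiv.subRight m).summable_iff.mpr this
  have hle : ∀ (f : lp (fun _ : Fin d → ℤ => ℂ) 2) l,
      ‖w l * f (l - m)‖ ^ (2 : ℝ) ≤ c ^ (2 : ℝ) * ‖f (l - m)‖ ^ (2 : ℝ) := fun f l => by
    rw [norm_mul, Real.mul_rpow (norm_nonneg _) (norm_nonneg _)]
    gcongr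
    exact hw l
  have hmem : ∀ f : lp (fun _ : Fin d → ℤ => ℂ) 2, Memℓp (fun l => w l * f (l - m)) 2 := by
    intro f
    rw [memℓp_gen_iff (by norm_num)]
    refine Summable.of_nonneg_of_le (fun _ => by positivity) (fun l => ?_)
      ((hsum f).mul_left (c ^ (2 : ℝ)))
    simpa using hle f l
  let D₀ : lp (fun _ : Fin d → ℤ => ℂ) 2 →ₗ[ℂ] lp (fun _ : Fin d → ℤ => ℂ) 2 :=
    { toFun := fun f => ⟨fun l => w l * f (l - m), hmem f⟩
      map_add' := fun f g => by
        ext l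
        exact mul_add _ _ _
      map_smul' := fun a f => by
        ext l
        exact mul_left_comm _ _ _ }
  have hD : ∀ f, ‖D₀ f‖ ≤ c * ‖f‖ := by
    intro f
    refine lp.norm_le_of_tsum_le (by norm_num) (by positivity) ?_
    have h2 : ((2 : ℝ≥0∞).toReal) = 2 := by norm_num
    rw [h2, Real.mul_rpow hc (norm_nonneg _)]
    have h3 : ‖f‖ ^ (2 : ℝ) = ∑' l, ‖f (l - m)‖ ^ (2 : ℝ) := by
      have := lp.norm_rpow_eq_tsum (p := 2) (by norm_num) f
      rw [h2] at this
      rw [this]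
      exact ((Equiv.subRight m).tsum_eq fun l => ‖f l‖ ^ (2 : ℝ)).symm
    rw [h3, ← tsum_mul_left]
    refine Summable.tsum_le_tsum (fun l => hle f l) ?_ ((hsum f).mul_left _)
    have := (hmem f).summable (by norm_num)
    simpa [D₀] using this
  let D₁ := D₀.mkContinuous c hD
  refine ⟨(b.repr.symm : lp (fun _ : Fin d → ℤ => ℂ) 2 →L[ℂ] E) ∘L D₁ ∘L
    (b.repr : E →L[ℂ] lp (fun _ : Fin d → ℤ => ℂ) 2), fun x l => ?_, ?_⟩
  · simp [D₁, D₀]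
  · refine ContinuousLinearMap.opNorm_le_bound _ hc fun x => ?_
    have := hD (b.repr x)
    simpa [D₁] using this

theorem banded_of_diagonal {m : Fin d → ℤ} {w : (Fin d → ℤ) → ℂ} {D : E →L[ℂ] E}
    (hD : ∀ x l, b.repr (D x) l = w l * b.repr x (l - m)) {r : ℝ} (hm : ‖m‖ ≤ r) :
    Banded b r D := by
  intro x l hl
  rw [hD] at hl
  exact ⟨l - m, right_ne_zero_of_mul hl, by simpa using hm⟩

/-- Off-diagonal decay of order `η` gives banded approximation of each order below `η - d`. -/
theorem exists_bandApprox_of_decay [CompleteSpace E] (hd : 1 ≤ d) {A : E →L[ℂ] E} {c η δ : ℝ}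
    (hA : ∀ l k, ‖b.repr (A (b k)) l‖ ≤ c * (1 + ‖l - k‖) ^ (-η)) (hc : 0 ≤ c)
    (hδ : 0 ≤ δ) (hδη : δ < η - d) : ∃ C, 0 ≤ C ∧ BandApprox b δ C A := by
  classical
  have hdec : ∀ m l, ‖b.repr (A (b (l - m))) l‖ ≤ c * (1 + ‖m‖) ^ (-η) := fun m l => by
    simpa using hA l (l - m)
  choose D hD hDn using fun m => exists_diagonal b m (fun l => b.repr (A (b (l - m))) l)
    (c := c * (1 + ‖m‖) ^ (-η)) (by positivity) (hdec m)
  have hs1 : Summable fun m : Fin d → ℤ => c * (1 + ‖m‖) ^ (-η) :=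
    (summable_one_add_norm_rpow hd (by linarith)).mul_left c
  have hs2 : Summable fun m : Fin d → ℤ => (1 + ‖m‖) ^ (-(η - δ)) :=
    summable_one_add_norm_rpow hd (by linarith)
  have hDs : Summable D := Summable.of_norm_bounded hs1 hDn
  -- `D m` is the side diagonal of `A` at offset `m`. The series converges absolutely in operator
  -- norm, and its sum agrees with `A` on the basis vectors, since only `m = l - k` contributes to
  -- the entry `(l, k)`.
  have hDA : HasSum D A := by
    suffices h : ∑' m, D m = A by
      rw [← h]
      exact hDs.hasSum
    refine ContinuousLinearMap.ext_on
      (Submodule.dense_iff_topologicalClosure_eq_top.mpr b.dense_span) ?_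
    rintro _ ⟨k, rfl⟩
    apply b.repr.injective
    ext l
    have h1 : HasSum (fun m => b.repr (D m (b k)) l) (b.repr ((∑' m, D m) (b k)) l) := by
      have := (hDs.hasSum.mapL (ContinuousLinearMap.apply ℂ E (b k))).mapL (innerSL ℂ (b l))
      simpa [b.repr_apply_apply] using this
    refine h1.unique ?_
    have h2 : (fun m => b.repr (D m (b k)) l) =
        fun m => if m = l - k then b.repr (A (b k)) l else 0 := by
      funext m
      rw [hD, b.repr_self]
      by_cases hm : m = l - k
      · subst hm
        simp
      · rw [if_neg hm, lp.single_apply_ne, mul_zero]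
        exact fun h => hm (by rw [← h]; abel)
    rw [h2]
    exact hasSum_ite_eq _ _
  refine ⟨c * ∑' m : Fin d → ℤ, (1 + ‖m‖) ^ (-(η - δ)),
    mul_nonneg hc (tsum_nonneg fun _ => by positivity), fun r hr => ?_⟩
  refine ⟨∑ m ∈ latticeBall d r, D m, Banded.sum _ fun m hm =>
    banded_of_diagonal (hD m) ((mem_latticeBall (by linarith) m).mp hm), ?_⟩
  have h3 : HasSum (fun m => if m ∈ latticeBall d r then 0 else D m)
      (A - ∑ m ∈ latticeBall d r, D m) := by
    have h := hDA.sub (hasSum_sum_of_ne_finset_zero (s := latticeBall d r)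
      (f := fun m => if m ∈ latticeBall d r then D m else 0) fun m hm => if_neg hm)
    rw [Finset.sum_congr rfl fun m hm => if_pos hm] at h
    have heq : (fun m => if m ∈ latticeBall d r then 0 else D m) =
        fun m => D m - if m ∈ latticeBall d r then D m else 0 := by
      funext m
      split_ifs <;> simp
    rw [heq]
    exact h
  rw [← h3.tsum_eq]
  refine tsum_of_norm_bounded (g := fun m => c * r ^ (-δ) * (1 + ‖m‖) ^ (-(η - δ))) ?_ fun m => ?_
  · rw [mul_right_comm]
    exact hs2.hasSum.mul_left (c * r ^ (-δ))
  · by_cases hm : m ∈ latticeBall d r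
    · rw [if_pos hm, norm_zero]
      positivity
    · rw [if_neg hm]
      refine (hDn m).trans ?_
      -- Outside the ball the weight splits: the power `-δ` gives the rate in `r`, and the power
      -- `-(η - δ)` is still summable because `η - δ > d`.
      have hmr : r ≤ 1 + ‖m‖ := by
        rw [mem_latticeBall (by linarith)] at hm
        linarith
      calc c * (1 + ‖m‖) ^ (-η) = c * ((1 + ‖m‖) ^ (-δ) * (1 + ‖m‖) ^ (-(η - δ))) := by
            rw [← Real.rpow_add (by positivity)]
            congr 2
            ring
        _ ≤ c * (r ^ (-δ) * (1 + ‖m‖) ^ (-(η - δ))) := by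
            gcongr c * (?_ * _)
            exact Real.rpow_le_rpow_of_nonpos (by linarith) hmr (by linarith)
        _ = _ := by ring

/-! ### Banded approximation and sparse vectors -/

theorem sum_pow_sub_le {g : ℝ} (hg0 : 0 ≤ g) (hg1 : g < 1) (n : ℕ) :
    ∑ j ∈ Finset.range (n + 1), g ^ (n - j) ≤ (1 - g)⁻¹ := by
  have h := Finset.sum_range_reflect (fun i => g ^ i) (n + 1)
  simp only [Nat.add_sub_cancel] at h
  rw [h, ← tsum_geometric_of_lt_one hg0 hg1]
  exact (summable_geometric_of_lt_one hg0 hg1).sum_le_tsum _ fun _ _ => by positivity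

/-- Approximation of `T x` on dyadic levels, for `x` with best `2^n`-term errors of order `β^n`. -/
theorem exists_suppIn_image_dyadic {T : E →L[ℂ] E} {S : ℕ → E →L[ℂ] E} {κ C β g h M : ℝ}
    (hβ0 : 0 < β) (hβ1 : β ≤ 1) (hg0 : 0 ≤ g) (hg1 : g < 1) (hh0 : 0 ≤ h) (hh1 : h < 1)
    (hκ : 0 ≤ κ) (hC : 0 ≤ C) (hM : 0 ≤ M)
    (hS : ∀ i Λ x, SuppIn b Λ x →
      ∃ Λ', SuppIn b Λ' (S i x) ∧ (Λ'.card : ℝ) ≤ κ * (2 * h) ^ i * Λ.card)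
    (hTS : ∀ i, ‖T - S i‖ ≤ C * (g * β) ^ i) {x : E} (hx : ‖x‖ ≤ M)
    (hxn : ∀ n : ℕ, ∃ Λ y, Λ.card ≤ 2 ^ n ∧ SuppIn b Λ y ∧ ‖x - y‖ ≤ M * β ^ n) (n : ℕ) :
    ∃ Λ y, (Λ.card : ℝ) ≤ κ * 2 * (1 - h)⁻¹ * 2 ^ n ∧ SuppIn b Λ y ∧
      ‖T x - y‖ ≤ (‖T‖ + 2 * β⁻¹ * C * (1 - g)⁻¹) * M * β ^ n := by
  classical
  choose Λ y hcard hsupp herr using hxn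
  -- Dyadic layers, telescoping to `y n`. The layer `j` has about `2 ^ j` terms and norm of order `β
  -- ^ j`.
  let D : ℕ → E := fun j => Nat.casesOn j (y 0) fun j => y (j + 1) - y j
  have hDsum : ∀ n, ∑ j ∈ Finset.range (n + 1), D j = y n := by
    intro n
    induction n with
    | zero => simp [D]
    | succ n ih => rw [Finset.sum_range_succ, ih, add_sub_cancel]
  have hDsupp : ∀ j, ∃ Λ' : Finset (Fin d → ℤ),
      (Λ'.card : ℝ) ≤ 2 * 2 ^ j ∧ SuppIn b Λ' (D j) := by
    intro j
    cases j with
    | zero =>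
      refine ⟨Λ 0, ?_, hsupp 0⟩
      have : ((Λ 0).card : ℝ) ≤ ((2 ^ 0 : ℕ) : ℝ) := by exact_mod_cast hcard 0
      norm_num at this ⊢
      linarith
    | succ j =>
      refine ⟨Λ (j + 1) ∪ Λ j, ?_, (hsupp (j + 1)).sub (hsupp j)⟩
      have h1 : (Λ (j + 1) ∪ Λ j).card ≤ 2 ^ (j + 1) + 2 ^ j :=
        (Finset.card_union_le _ _).trans (add_le_add (hcard _) (hcard _))
      have h2 : ((Λ (j + 1) ∪ Λ j).card : ℝ) ≤ 2 ^ (j + 1) + 2 ^ j := by exact_mod_cast h1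
      have h3 : (0 : ℝ) < 2 ^ j := by positivity
      rw [pow_succ] at h2 ⊢
      linarith
  have hDn : ∀ j, ‖D j‖ ≤ 2 * β⁻¹ * M * β ^ j := by
    intro j
    have hβi : 1 ≤ β⁻¹ := (one_le_inv₀ hβ0).mpr hβ1
    cases j with
    | zero =>
      have h0 := herr 0
      rw [pow_zero, mul_one] at h0 ⊢
      calc ‖D 0‖ = ‖x - (x - y 0)‖ := by simp [D]
        _ ≤ M + M := (norm_sub_le _ _).trans (add_le_add hx h0)
        _ = 2 * 1 * M := by ring
        _ ≤ 2 * β⁻¹ * M := by gcongr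
    | succ j =>
      calc ‖D (j + 1)‖ = ‖(x - y j) - (x - y (j + 1))‖ := by simp [D]
        _ ≤ M * β ^ j + M * β ^ (j + 1) :=
          (norm_sub_le _ _).trans (add_le_add (herr _) (herr _))
        _ ≤ M * β ^ j + M * β ^ j := by
          gcongr M * β ^ j + M * ?_
          exact pow_le_pow_of_le_one hβ0.le hβ1 (Nat.le_succ j)
        _ = 2 * β⁻¹ * M * β ^ (j + 1) := by
          field_simp
          ring
  choose Γ hΓc hΓ using hDsupp
  -- The layer `j` is paired with the operator of level `n - j`. Supports are then of size `2 ^ n *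
  -- h ^ (n - j)` and errors of size `β ^ n * g ^ (n - j)`, up to constants; both are geometric in
  -- `n - j`.
  choose Γ' hΓ' hΓ'c using fun j => hS (n - j) (Γ j) (D j) (hΓ j)
  refine ⟨(Finset.range (n + 1)).biUnion Γ', ∑ j ∈ Finset.range (n + 1), S (n - j) (D j), ?_,
    SuppIn.sum _ fun j _ => hΓ' j, ?_⟩
  · calc (((Finset.range (n + 1)).biUnion Γ').card : ℝ)
        ≤ ∑ j ∈ Finset.range (n + 1), ((Γ' j).card : ℝ) := by
          exact_mod_cast Finset.card_biUnion_le
      _ ≤ ∑ j ∈ Finset.range (n + 1), κ * 2 * 2 ^ n * h ^ (n - j) := by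
          refine Finset.sum_le_sum fun j hj => ?_
          have hjn : j ≤ n := Nat.lt_succ_iff.mp (Finset.mem_range.mp hj)
          calc ((Γ' j).card : ℝ) ≤ κ * (2 * h) ^ (n - j) * (Γ j).card := hΓ'c j
            _ ≤ κ * (2 * h) ^ (n - j) * (2 * 2 ^ j) := by
              gcongr
              exact hΓc j
            _ = κ * 2 * (2 ^ (n - j) * 2 ^ j) * h ^ (n - j) := by
              rw [mul_pow]
              ring
            _ = _ := by rw [← pow_add, Nat.sub_add_cancel hjn]
      _ = κ * 2 * 2 ^ n * ∑ j ∈ Finset.range (n + 1), h ^ (n - j) := by rw [Finset.mul_sum]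
      _ ≤ κ * 2 * 2 ^ n * (1 - h)⁻¹ := by
          gcongr
          exact sum_pow_sub_le hh0 hh1 n
      _ = _ := by ring
  · have hsplit : T x - ∑ j ∈ Finset.range (n + 1), S (n - j) (D j) =
        T (x - y n) + ∑ j ∈ Finset.range (n + 1), (T - S (n - j)) (D j) := by
      simp only [sub_apply, Finset.sum_sub_distrib, ← map_sum, hDsum, map_sub]
      abel
    rw [hsplit]
    calc _ ≤ ‖T (x - y n)‖ + ∑ j ∈ Finset.range (n + 1), ‖(T - S (n - j)) (D j)‖ :=
          (norm_add_le _ _).trans (add_le_add le_rfl (norm_sum_le _ _))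
      _ ≤ ‖T‖ * (M * β ^ n) + ∑ j ∈ Finset.range (n + 1),
            2 * β⁻¹ * C * M * β ^ n * g ^ (n - j) := by
          refine add_le_add ((T.le_opNorm _).trans ?_) (Finset.sum_le_sum fun j hj => ?_)
          · gcongr
            exact herr n
          · have hjn : j ≤ n := Nat.lt_succ_iff.mp (Finset.mem_range.mp hj)
            calc ‖(T - S (n - j)) (D j)‖ ≤ ‖T - S (n - j)‖ * ‖D j‖ :=
                  ContinuousLinearMap.le_opNorm _ _
              _ ≤ C * (g * β) ^ (n - j) * (2 * β⁻¹ * M * β ^ j) := by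
                  gcongr
                  · exact hTS _
                  · exact hDn j
              _ = 2 * β⁻¹ * C * M * (β ^ (n - j) * β ^ j) * g ^ (n - j) := by
                  rw [mul_pow]
                  ring
              _ = _ := by rw [← pow_add, Nat.sub_add_cancel hjn]
      _ = ‖T‖ * (M * β ^ n) + 2 * β⁻¹ * C * M * β ^ n *
            ∑ j ∈ Finset.range (n + 1), g ^ (n - j) := by rw [Finset.mul_sum]
      _ ≤ ‖T‖ * (M * β ^ n) + 2 * β⁻¹ * C * M * β ^ n * (1 - g)⁻¹ := by
          gcongr
          exact sum_pow_sub_le hg0 hg1 n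
      _ = _ := by ring

theorem Sparse.nonneg {t M : ℝ} {x : E} (hx : Sparse b t M x) : 0 ≤ M :=
  (norm_nonneg x).trans hx.1

theorem Sparse.mono {t M M' : ℝ} {x : E} (hx : Sparse b t M x) (h : M ≤ M') :
    Sparse b t M' x := by
  refine ⟨hx.1.trans h, fun N hN => ?_⟩
  obtain ⟨Λ, y, hc, hy, he⟩ := hx.2 N hN
  exact ⟨Λ, y, hc, hy, he.trans (by gcongr)⟩

/-- It is enough to bound the approximation errors on dyadic levels. -/
theorem sparse_of_dyadic {t κ K : ℝ} (ht : 0 ≤ t) (hκ : 1 ≤ κ) {x : E} (hx : ‖x‖ ≤ K)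
    (hxn : ∀ n : ℕ, ∃ Λ y, (Λ.card : ℝ) ≤ κ * 2 ^ n ∧ SuppIn b Λ y ∧
      ‖x - y‖ ≤ K * ((2 : ℝ) ^ (-t)) ^ n) : Sparse b t ((2 * κ) ^ t * K) x := by
  have hK : 0 ≤ K := (norm_nonneg x).trans hx
  have h1 : 1 ≤ (2 * κ) ^ t := Real.one_le_rpow (by linarith) ht
  refine ⟨hx.trans (le_mul_of_one_le_left hK h1), fun N hN => ?_⟩
  have hN0 : (0 : ℝ) < N := by exact_mod_cast hN
  rcases lt_or_ge (N : ℝ) κ with hlt | hge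
  -- No dyadic level fits into `N < κ` terms, so the zero vector is used; the factor `(2 * κ) ^ t`
  -- absorbs this.
  · refine ⟨∅, 0, by simp, suppIn_zero _, ?_⟩
    rw [sub_zero]
    refine hx.trans ?_
    have h2 : 1 ≤ (2 * κ) ^ t * (N : ℝ) ^ (-t) := by
      rw [Real.rpow_neg hN0.le, ← div_eq_mul_inv, one_le_div (by positivity)]
      exact Real.rpow_le_rpow hN0.le (by linarith) ht
    calc K ≤ K * ((2 * κ) ^ t * (N : ℝ) ^ (-t)) := le_mul_of_one_le_right hK h2
      _ = _ := by ring
  · have hκ0 : 0 < κ := by linarith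
    -- The largest level with `κ * 2 ^ n ≤ N`; then `N < 2 * κ * 2 ^ n`, which accounts for the
    -- constant `(2 * κ) ^ t`.
    obtain ⟨n, hn1, hn2⟩ := exists_nat_pow_near ((one_le_div hκ0).mpr hge) one_lt_two
    rw [le_div_iff₀ hκ0] at hn1
    rw [div_lt_iff₀ hκ0] at hn2
    obtain ⟨Λ, y, hc, hy, he⟩ := hxn n
    refine ⟨Λ, y, ?_, hy, he.trans ?_⟩
    · have : (Λ.card : ℝ) ≤ N := by linarith
      exact_mod_cast this
    · have h3 : ((2 : ℝ) ^ (-t)) ^ n ≤ (2 * κ) ^ t * (N : ℝ) ^ (-t) := by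
        rw [Real.rpow_neg hN0.le, ← div_eq_mul_inv, le_div_iff₀ (by positivity)]
        calc ((2 : ℝ) ^ (-t)) ^ n * (N : ℝ) ^ t
            ≤ ((2 : ℝ) ^ (-t)) ^ n * (2 * κ * 2 ^ n) ^ t := by
              gcongr
              rw [pow_succ] at hn2
              linarith
          _ = (2 * κ) ^ t := by
              rw [Real.mul_rpow (by positivity) (by positivity), ← Real.rpow_natCast,
                ← Real.rpow_natCast, ← Real.rpow_mul (by norm_num), ← Real.rpow_mul (by norm_num),
                mul_left_comm, ← Real.rpow_add (by norm_num)]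
              simp [mul_comm]
      calc K * ((2 : ℝ) ^ (-t)) ^ n ≤ K * ((2 * κ) ^ t * (N : ℝ) ^ (-t)) := by gcongr
        _ = _ := by ring

/-- An operator with banded approximations of order `δ > t d` preserves sparsity of order `t`. -/
theorem exists_sparse_map (hd : 1 ≤ d) {t δ C B : ℝ} (ht : 0 < t) (hδ : t * d < δ)
    (hC : 0 ≤ C) (hB : 0 ≤ B) : ∃ K, 0 ≤ K ∧ ∀ T : E →L[ℂ] E, BandApprox b δ C T → ‖T‖ ≤ B →
      ∀ M x, Sparse b t M x → Sparse b t (K * M) (T x) := by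
  have hd0 : (0 : ℝ) < d := by exact_mod_cast hd
  have htd : 0 < t * d := by positivity
  have hδ0 : 0 < δ := htd.trans hδ
  -- The operator of level `i` has band width `2 ^ (θ * i / d)`. It multiplies supports by `3 ^ d *
  -- (2 * h) ^ i` and has error `C * (g * β) ^ i`. Here `h < 1` requires `θ < 1`, and `g < 1`
  -- requires `θ * δ > t * d`; `θ * δ` is taken midway between `t * d` and `δ`.
  set θ := (t * d + δ) / (2 * δ) with hθ
  have hθδ : θ * δ = (t * d + δ) / 2 := by
    rw [hθ]
    field_simp
  have hθ0 : 0 < θ := by positivity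
  have hθ1 : θ < 1 := by
    rw [hθ, div_lt_one (by positivity)]
    linarith
  set β : ℝ := 2 ^ (-t) with hβ
  set g : ℝ := 2 ^ (t - θ * δ / d) with hg
  set h : ℝ := 2 ^ (θ - 1) with hh
  have hβ1 : β ≤ 1 := Real.rpow_le_one_of_one_le_of_nonpos one_le_two (by linarith)
  have hg1 : g < 1 := by
    refine Real.rpow_lt_one_of_one_lt_of_neg one_lt_two ?_
    rw [hθδ, sub_neg, lt_div_iff₀ hd0]
    linarith
  have hh1 : h < 1 := Real.rpow_lt_one_of_one_lt_of_neg one_lt_two (by linarith)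
  have h1h : 0 < 1 - h := by linarith
  have h1g : 0 < 1 - g := by linarith
  have hh0 : 0 < h := by positivity
  set κ : ℝ := 3 ^ d * 2 * (1 - h)⁻¹ with hκ
  have hκ1 : 1 ≤ κ := by
    have e1 : (1 : ℝ) ≤ 3 ^ d := one_le_pow₀ (by norm_num)
    have e2 : 1 ≤ (1 - h)⁻¹ := (one_le_inv₀ h1h).mpr (by linarith)
    nlinarith [mul_le_mul e1 e2 zero_le_one (by positivity)]
  set K₁ := B + 2 * β⁻¹ * C * (1 - g)⁻¹ with hK₁
  have hBK : B ≤ K₁ := le_add_of_nonneg_right (by positivity)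
  refine ⟨(2 * κ) ^ t * K₁, by positivity, fun T hT hTB M x hx => ?_⟩
  have hM := hx.nonneg
  have hr1 : ∀ i : ℕ, (1 : ℝ) ≤ 2 ^ (θ * i / d) := fun i =>
    Real.one_le_rpow one_le_two (by positivity)
  choose S hSb hSn using fun i : ℕ => hT (2 ^ (θ * i / d)) (hr1 i)
  rw [mul_assoc]
  refine sparse_of_dyadic ht.le hκ1 ?_ fun n => ?_
  · calc ‖T x‖ ≤ ‖T‖ * ‖x‖ := T.le_opNorm x
      _ ≤ K₁ * M := mul_le_mul (hTB.trans hBK) hx.1 (norm_nonneg _) (hB.trans hBK)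
  · obtain ⟨Λ, y, hc, hy, he⟩ := exists_suppIn_image_dyadic (T := T) (S := S) (κ := 3 ^ d)
      (C := C) (β := β) (g := g) (h := h) (M := M) (x := x) (by positivity) hβ1 (by positivity)
      hg1 hh0.le hh1 (by positivity) hC hM
      (by
        intro i Λ z hz
        obtain ⟨Λ', hΛ', hc⟩ := (hSb i).exists_suppIn (hr1 i) hz
        refine ⟨Λ', hΛ', hc.trans (le_of_eq ?_)⟩
        have e1 : (2 * h) ^ i = ((2 : ℝ) ^ (θ * i / d)) ^ d := by
          have e2 : 2 * h = 2 ^ θ := by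
            rw [hh, Real.rpow_sub (by norm_num), Real.rpow_one]
            ring
          rw [e2, ← Real.rpow_natCast, ← Real.rpow_natCast, ← Real.rpow_mul (by norm_num),
            ← Real.rpow_mul (by norm_num)]
          congr 1
          field_simp
        rw [e1, mul_pow])
      (by
        intro i
        refine (hSn i).trans (le_of_eq ?_)
        congr 1
        rw [hg, hβ, ← Real.rpow_add (by norm_num), ← Real.rpow_natCast,
          ← Real.rpow_mul (by norm_num), ← Real.rpow_mul (by norm_num)]
        congr 1
        field_simp
        ring)
      hx.1
      (by
        intro n
        obtain ⟨Λ, y, hc, hy, he⟩ := hx.2 (2 ^ n) Nat.one_le_two_pow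
        refine ⟨Λ, y, hc, hy, he.trans (le_of_eq ?_)⟩
        congr 1
        rw [hβ, Nat.cast_pow, Nat.cast_ofNat, ← Real.rpow_natCast, ← Real.rpow_natCast,
          ← Real.rpow_mul (by norm_num), ← Real.rpow_mul (by norm_num), mul_comm])
      n
    refine ⟨Λ, y, hc, hy, he.trans ?_⟩
    rw [hK₁]
    gcongr

/-- Each vector receives half of the `N` terms. Since `N ≤ 3 * (N / 2)` for `N ≥ 2`, this costs `3 ^
t`; for `N = 1` the zero vector is enough. -/
theorem Sparse.sub {t M M' : ℝ} {x y : E} (ht : 0 ≤ t) (hx : Sparse b t M x)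
    (hy : Sparse b t M' y) : Sparse b t (3 ^ t * (M + M')) (x - y) := by
  classical
  have hM : 0 ≤ M + M' := add_nonneg hx.nonneg hy.nonneg
  have hn : ‖x - y‖ ≤ M + M' := (norm_sub_le _ _).trans (add_le_add hx.1 hy.1)
  have h3 : (1 : ℝ) ≤ 3 ^ t := Real.one_le_rpow (by norm_num) ht
  refine ⟨hn.trans (le_mul_of_one_le_left hM h3), fun N hN => ?_⟩
  rcases hN.eq_or_lt with rfl | hN
  · refine ⟨∅, 0, by simp, suppIn_zero _, ?_⟩
    simpa using hn.trans (le_mul_of_one_le_left hM h3)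
  · obtain ⟨Λ, u, hc, hu, he⟩ := hx.2 (N / 2) (by omega)
    obtain ⟨Λ', u', hc', hu', he'⟩ := hy.2 (N / 2) (by omega)
    refine ⟨Λ ∪ Λ', u - u', (Finset.card_union_le _ _).trans (by omega), hu.sub hu', ?_⟩
    have h1 : (N : ℝ) / 3 ≤ (N / 2 : ℕ) := by
      have : N ≤ 3 * (N / 2) := by omega
      have : (N : ℝ) ≤ 3 * (N / 2 : ℕ) := by exact_mod_cast this
      linarith
    have hN0 : (0 : ℝ) < N := by
      have : 0 < N := by omega
      exact_mod_cast this
    have h2 : ((N / 2 : ℕ) : ℝ) ^ (-t) ≤ 3 ^ t * (N : ℝ) ^ (-t) := by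
      calc ((N / 2 : ℕ) : ℝ) ^ (-t) ≤ ((N : ℝ) / 3) ^ (-t) :=
            Real.rpow_le_rpow_of_nonpos (by positivity) h1 (by linarith)
        _ = _ := by
            rw [Real.div_rpow hN0.le (by norm_num), Real.rpow_neg (by norm_num : (0 : ℝ) ≤ 3),
              div_inv_eq_mul, mul_comm]
    calc ‖x - y - (u - u')‖ = ‖(x - u) - (y - u')‖ := by
          congr 1
          abel
      _ ≤ M * ((N / 2 : ℕ) : ℝ) ^ (-t) + M' * ((N / 2 : ℕ) : ℝ) ^ (-t) :=
          (norm_sub_le _ _).trans (add_le_add he he')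
      _ = (M + M') * ((N / 2 : ℕ) : ℝ) ^ (-t) := by ring
      _ ≤ (M + M') * (3 ^ t * (N : ℝ) ^ (-t)) := by gcongr
      _ = _ := by ring

/-! ### Banded approximation of the Neumann series -/

theorem exists_pow_le_rpow_neg {q p : ℝ} (hq0 : 0 ≤ q) (hq1 : q < 1) :
    ∃ K, 0 ≤ K ∧ ∀ n : ℕ, q ^ n ≤ K * ((n : ℝ) + 1) ^ (-p) := by
  obtain ⟨B, hB⟩ := (tendsto_pow_const_mul_const_pow_of_lt_one ⌈p⌉₊ hq0 hq1).bddAbove_range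
  have hB' : ∀ n : ℕ, (n : ℝ) ^ ⌈p⌉₊ * q ^ n ≤ B := fun n => hB ⟨n, rfl⟩
  have hB0 : 0 ≤ B := le_trans (by positivity) (hB' 0)
  -- The summand `1` covers `n = 0`, where `n + 1 ≤ 2 * n` fails.
  refine ⟨2 ^ ⌈p⌉₊ * B + 1, by positivity, fun n => ?_⟩
  rw [Real.rpow_neg (by positivity), ← div_eq_mul_inv, le_div_iff₀ (by positivity)]
  have h1 : ((n : ℝ) + 1) ^ p ≤ ((n : ℝ) + 1) ^ ⌈p⌉₊ := by
    rw [← Real.rpow_natCast]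
    exact Real.rpow_le_rpow_of_exponent_le (by linarith [n.cast_nonneg (α := ℝ)]) (Nat.le_ceil p)
  refine (mul_le_mul_of_nonneg_left h1 (by positivity)).trans ?_
  rcases Nat.eq_zero_or_pos n with rfl | hn
  · simpa using by positivity
  · have hn1 : (1 : ℝ) ≤ n := by exact_mod_cast hn
    calc q ^ n * ((n : ℝ) + 1) ^ ⌈p⌉₊ ≤ q ^ n * (2 * n) ^ ⌈p⌉₊ := by
          gcongr
          linarith
      _ = 2 ^ ⌈p⌉₊ * ((n : ℝ) ^ ⌈p⌉₊ * q ^ n) := by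
          rw [mul_pow]
          ring
      _ ≤ 2 ^ ⌈p⌉₊ * B := by
          gcongr
          exact hB' n
      _ ≤ _ := by linarith

theorem norm_geom_sum_le {S : E →L[ℂ] E} {q : ℝ} (hq1 : q < 1) (hS : ‖S‖ ≤ q) (n : ℕ) :
    ‖∑ i ∈ Finset.range n, S ^ i‖ ≤ (1 - q)⁻¹ := by
  have hq0 : 0 ≤ q := (norm_nonneg S).trans hS
  calc ‖∑ i ∈ Finset.range n, S ^ i‖ ≤ ∑ i ∈ Finset.range n, q ^ i := by
        refine (norm_sum_le _ _).trans (Finset.sum_le_sum fun i _ => ?_)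
        -- Only an inequality, because `E` may be trivial.
        have h1 : ‖(1 : E →L[ℂ] E)‖ ≤ 1 := ContinuousLinearMap.norm_id_le
        cases i with
        | zero => simpa using h1
        | succ i => exact (norm_pow_le' S (Nat.succ_pos i)).trans (by gcongr)
    _ ≤ (1 - q)⁻¹ := by
        rw [← tsum_geometric_of_lt_one hq0 hq1]
        exact (summable_geometric_of_lt_one hq0 hq1).sum_le_tsum _ fun _ _ => by positivity

/-- The inverse of `1 - T` with `‖T‖ < 1` inherits banded approximation from `T`, with an
arbitrarily small loss in the order. -/
theorem exists_bandApprox_inverse {q δ δ' C : ℝ} (hq0 : 0 ≤ q) (hq1 : q < 1) (hC : 0 ≤ C)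
    (hδ' : 0 < δ') (hδ : δ' < δ) : ∃ C', 0 ≤ C' ∧ ∀ T X : E →L[ℂ] E, BandApprox b δ C T →
      ‖T‖ ≤ q → X * (1 - T) = 1 → ‖X‖ ≤ (1 - q)⁻¹ → BandApprox b δ' C' X := by
  have hδ0 : 0 < δ := hδ'.trans hδ
  -- The allowed width `R` is shared between the width `r = R ^ (1 - ε)` of an approximation `S` of
  -- `T` and the number `n` of Neumann terms, about `R ^ ε`. By the choice of `ε`, `r ^ (-δ) = R ^
  -- (-δ')`. The tail `q' ^ n` decays faster than any power of `n`; the power `δ' / ε` gives `R ^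
  -- (-δ')` again.
  set ε := 1 - δ' / δ with hε
  have hε0 : 0 < ε := by
    rw [hε, sub_pos, div_lt_one hδ0]
    exact hδ
  have hε1 : (1 - ε) * δ = δ' := by
    rw [hε]
    field_simp
    ring
  have hε2 : 0 < 1 - ε := by
    rw [hε]
    have : 0 < δ' / δ := by positivity
    linarith
  -- A contraction constant for `S` as soon as `‖T - S‖ ≤ (1 - q) / 2`.
  set q' := (1 + q) / 2 with hq'
  have hq'1 : q' < 1 := by linarith
  have hq'0 : 0 ≤ q' := by linarith
  have h1q : 0 < 1 - q := by linarith
  have h1q' : 0 < 1 - q' := by linarith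
  obtain ⟨K, hK0, hK⟩ := exists_pow_le_rpow_neg (p := δ' / ε) hq'0 hq'1
  refine ⟨(1 - q)⁻¹ * (K + C * (1 - q')⁻¹), by positivity, fun T X hT hTq hX hXn R hR => ?_⟩
  have hR0 : 0 < R := by linarith
  set r := R ^ (1 - ε) with hr
  have hr1 : 1 ≤ r := Real.one_le_rpow hR hε2.le
  obtain ⟨S, hSb, hSn⟩ := hT r hr1
  have hrδ : r ^ (-δ) = R ^ (-δ') := by
    rw [hr, ← Real.rpow_mul hR0.le, ← hε1]
    congr 1
    ring
  rw [hrδ] at hSn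
  by_cases hcase : ‖T - S‖ ≤ (1 - q) / 2
  · have hSq : ‖S‖ ≤ q' := by
      calc ‖S‖ = ‖T - (T - S)‖ := by rw [sub_sub_cancel]
        _ ≤ q + (1 - q) / 2 := (norm_sub_le _ _).trans (add_le_add hTq hcase)
        _ = q' := by ring
    set n := ⌊R ^ ε⌋₊ with hn
    have hnr : n * r ≤ R := by
      calc n * r ≤ R ^ ε * r := by
            gcongr
            exact Nat.floor_le (by positivity)
        _ = R := by
            rw [hr, ← Real.rpow_add hR0]
            simp
    set B := ∑ i ∈ Finset.range n, S ^ i with hB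
    refine ⟨B, Banded.sum _ fun i hi => ((hSb.pow i).mono ?_), ?_⟩
    · have : (i : ℝ) ≤ n := by exact_mod_cast (Finset.mem_range.mp hi).le
      exact (mul_le_mul_of_nonneg_right this (by linarith)).trans hnr
    · have hgeom : (1 - S) * B = 1 - S ^ n := by
        rw [hB, mul_neg_geom_sum]
      -- This follows from `B = X * (1 - T) * B` and `(1 - S) * B = 1 - S ^ n`; it separates the
      -- truncation error from the banding error.
      have hid : X - B = X * (S ^ n + (T - S) * B) := by
        have e1 : (T - S) * B = (1 - S) * B - (1 - T) * B := by noncomm_ring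
        rw [e1, hgeom, mul_add, mul_sub, ← mul_assoc X (1 - T) B, hX, mul_sub]
        noncomm_ring
      have hSn' : ‖S ^ n‖ ≤ K * R ^ (-δ') := by
        have h1 : 1 ≤ n := by
          rw [hn, Nat.one_le_floor_iff]
          exact Real.one_le_rpow hR hε0.le
        calc ‖S ^ n‖ ≤ ‖S‖ ^ n := norm_pow_le' S h1
          _ ≤ q' ^ n := by gcongr
          _ ≤ K * ((n : ℝ) + 1) ^ (-(δ' / ε)) := hK n
          _ ≤ K * (R ^ ε) ^ (-(δ' / ε)) := by
            gcongr K * ?_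
            refine Real.rpow_le_rpow_of_nonpos (by positivity) (Nat.lt_floor_add_one _).le ?_
            have : 0 < δ' / ε := by positivity
            linarith
          _ = K * R ^ (-δ') := by
            rw [← Real.rpow_mul hR0.le]
            congr 2
            field_simp
      rw [hid]
      calc ‖X * (S ^ n + (T - S) * B)‖ ≤ ‖X‖ * (‖S ^ n‖ + ‖T - S‖ * ‖B‖) :=
            (norm_mul_le _ _).trans (by
              gcongr
              exact (norm_add_le _ _).trans (add_le_add le_rfl (norm_mul_le _ _)))
        _ ≤ (1 - q)⁻¹ * (K * R ^ (-δ') + C * R ^ (-δ') * (1 - q')⁻¹) := by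
            gcongr
            exact norm_geom_sum_le hq'1 hSq n
        _ = _ := by ring
  -- Here `C * R ^ (-δ')` exceeds `(1 - q) / 2`, so the bound on `‖X‖` alone has the required form.
  · refine ⟨0, Banded.zero _, ?_⟩
    rw [sub_zero]
    push Not at hcase
    have h1 : 1 ≤ (1 - q')⁻¹ * (C * R ^ (-δ')) := by
      have : 1 - q' = (1 - q) / 2 := by ring
      rw [inv_mul_eq_div, one_le_div h1q', this]
      exact hcase.le.trans hSn
    calc ‖X‖ ≤ (1 - q)⁻¹ * 1 := by rw [mul_one]; exact hXn
      _ ≤ (1 - q)⁻¹ * ((1 - q')⁻¹ * (C * R ^ (-δ')) + K * R ^ (-δ')) := by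
          gcongr
          exact le_add_of_le_of_nonneg h1 (by positivity)
      _ = _ := by ring

/-! ### Galerkin residuals of coercive operators -/

theorem Banded.bandApprox {S : E →L[ℂ] E} (hS : Banded b 0 S) (δ : ℝ) : BandApprox b δ 0 S :=
  fun r hr => ⟨S, hS.mono (by linarith), by simp⟩

theorem exists_truncation (b : HilbertBasis (Fin d → ℤ) ℂ E) (Λ : Finset (Fin d → ℤ)) :
    ∃ P : E →L[ℂ] E, (∀ x, ∀ l ∈ Λ, b.repr (P x) l = b.repr x l) ∧
      (∀ x, ∀ l ∉ Λ, b.repr (P x) l = 0) ∧ ‖P‖ ≤ 1 ∧ Banded b 0 P := by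
  classical
  obtain ⟨P, hP, hPn⟩ := exists_diagonal b 0 (fun l => if l ∈ Λ then 1 else 0) zero_le_one
    (fun l => by split_ifs <;> simp)
  refine ⟨P, fun x l hl => ?_, fun x l hl => ?_, hPn, banded_of_diagonal hP (by simp)⟩
  · simp [hP, hl]
  · simp [hP, hl]

/-- The Richardson iteration for a coercive operator is a contraction. -/
theorem norm_sub_smul_le {A : E →L[ℂ] E} {α β : ℝ} (hα : 0 < α) (hβ : 0 < β)
    (hA : ∀ x, α * ‖x‖ ^ 2 ≤ (inner ℂ x (A x)).re) (hAβ : ‖A‖ ≤ β) :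
    ‖1 - ((α / β ^ 2 : ℝ) : ℂ) • A‖ ≤ √(1 - α ^ 2 / β ^ 2) := by
  refine ContinuousLinearMap.opNorm_le_bound _ (Real.sqrt_nonneg _) fun x => ?_
  -- The minimizer of `1 - 2 * τ * α + τ ^ 2 * β ^ 2`, with minimum `1 - α ^ 2 / β ^ 2`.
  set τ := α / β ^ 2 with hτ
  have hτ0 : 0 < τ := by positivity
  have h1 : ‖A x‖ ≤ β * ‖x‖ := (A.le_opNorm x).trans (by gcongr)
  have h2 : ‖(1 - (τ : ℂ) • A) x‖ ^ 2 =
      ‖x‖ ^ 2 - 2 * (τ * (inner ℂ x (A x)).re) + τ ^ 2 * ‖A x‖ ^ 2 := by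
    rw [sub_apply, smul_apply, one_apply_eq_self, @norm_sub_sq ℂ, inner_smul_right, norm_smul,
      Complex.norm_real, Real.norm_eq_abs, abs_of_pos hτ0, mul_pow]
    simp
  have h3 : ‖(1 - (τ : ℂ) • A) x‖ ^ 2 ≤ (1 - α ^ 2 / β ^ 2) * ‖x‖ ^ 2 := by
    rw [h2]
    calc ‖x‖ ^ 2 - 2 * (τ * (inner ℂ x (A x)).re) + τ ^ 2 * ‖A x‖ ^ 2
        ≤ ‖x‖ ^ 2 - 2 * (τ * (α * ‖x‖ ^ 2)) + τ ^ 2 * (β * ‖x‖) ^ 2 := by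
          gcongr
          exact hA x
      _ = (1 - α ^ 2 / β ^ 2) * ‖x‖ ^ 2 := by
          rw [hτ]
          field_simp
          ring
  rw [← Real.sqrt_sq (norm_nonneg x), ← Real.sqrt_mul' _ (sq_nonneg _)]
  exact Real.le_sqrt_of_sq_le h3

/-- The Galerkin residuals `A (x - w)` of sparse vectors `x` are sparse, uniformly in the index
set, if `A` is coercive and has banded approximations of order `δ > t d`. -/
theorem exists_sparse_residual [CompleteSpace E] (hd : 1 ≤ d) {A : E →L[ℂ] E} {α δ t C : ℝ}
    (hα : 0 < α) (hA : ∀ x, α * ‖x‖ ^ 2 ≤ (inner ℂ x (A x)).re) (hC : 0 ≤ C)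
    (hAb : BandApprox b δ C A) (ht : 0 < t) (hδ : t * d < δ) :
    ∃ K, 0 ≤ K ∧ ∀ M x, Sparse b t M x → ∀ Λ w, SuppIn b Λ w →
      (∀ k ∈ Λ, b.repr (A w) k = b.repr (A x) k) → Sparse b t (K * M) (A x - A w) := by
  have hd0 : (0 : ℝ) < d := by exact_mod_cast hd
  have htd : 0 < t * d := by positivity
  -- Adding `α` keeps `β` positive even when `A = 0`, which can occur on the trivial space.
  set β := ‖A‖ + α with hβdef
  have hβ : 0 < β := by positivity
  have hαβ : α ≤ β := by linarith [norm_nonneg A]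
  set τ := α / β ^ 2 with hτ
  have hτ0 : 0 < τ := by positivity
  set q := √(1 - α ^ 2 / β ^ 2) with hq
  have hq0 : 0 ≤ q := Real.sqrt_nonneg _
  have hq1 : q < 1 := by
    rw [hq, Real.sqrt_lt' one_pos]
    have : 0 < α ^ 2 / β ^ 2 := by positivity
    linarith
  have h1q : 0 < 1 - q := by linarith
  set G : E →L[ℂ] E := 1 - (τ : ℂ) • A with hG
  have hGq : ‖G‖ ≤ q := norm_sub_smul_le hα hβ hA (by linarith)
  obtain ⟨δ', hδ'1, hδ'2⟩ := exists_between hδ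
  obtain ⟨C', hC', hX⟩ := exists_bandApprox_inverse (b := b) (C := τ * C) hq0 hq1 (by positivity)
    (htd.trans hδ'1) hδ'2
  obtain ⟨K₁, hK₁, hs₁⟩ := exists_sparse_map (b := b) hd ht hδ hC (norm_nonneg A)
  obtain ⟨K₂, hK₂, hs₂⟩ := exists_sparse_map (b := b) hd ht hδ le_rfl hτ0.le
  obtain ⟨K₃, hK₃, hs₃⟩ := exists_sparse_map (b := b) (B := (1 - q)⁻¹) hd ht hδ'1 hC'
    (by positivity)
  -- `K₁`, `K₂`, `K₃` belong to `A`, `τ P` and `(1 - T)⁻¹`. All are fixed before `Λ`, which is where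
  -- the uniformity lies.
  refine ⟨3 ^ t * (K₁ + K₁ * (K₃ * (K₂ * K₁))), by positivity, fun M x hx Λ w hw hwA => ?_⟩
  obtain ⟨P, hP1, hP2, hPn, hPb⟩ := exists_truncation b Λ
  have hPw : P w = w := by
    apply b.repr.injective
    ext l
    by_cases hl : l ∈ Λ
    · exact hP1 w l hl
    · rw [hP2 w l hl]
      by_contra h
      exact hl (hw l (Ne.symm h))
  have hPA : P (A w) = P (A x) := by
    apply b.repr.injective
    ext l
    by_cases hl : l ∈ Λ
    · rw [hP1 _ l hl, hP1 _ l hl, hwA l hl]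
    · rw [hP2 _ l hl, hP2 _ l hl]
  have hPSP : ∀ S : E →L[ℂ] E, ‖P * S * P‖ ≤ ‖S‖ := fun S => by
    calc ‖P * S * P‖ ≤ ‖P‖ * ‖S‖ * ‖P‖ :=
          (norm_mul_le _ _).trans (by gcongr; exact norm_mul_le _ _)
      _ ≤ 1 * ‖S‖ * 1 := by gcongr
      _ = ‖S‖ := by ring
  set T := P * G * P with hT
  have hTq : ‖T‖ ≤ q := (hPSP G).trans hGq
  have hTb : BandApprox b δ (τ * C) T := by
    intro r hr
    obtain ⟨S, hS, hSn⟩ := hAb r hr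
    refine ⟨P * (1 - (τ : ℂ) • S) * P, ?_, ?_⟩
    · have := (hPb.mul ((Banded.one (by linarith)).sub (hS.smul (τ : ℂ)))).mul hPb
      rwa [zero_add, add_zero] at this
    · have h1 : T - P * (1 - (τ : ℂ) • S) * P = P * ((τ : ℂ) • (S - A)) * P := by
        rw [hT, hG, ← sub_mul, ← mul_sub, smul_sub]
        congr 2
        abel
      rw [h1, mul_assoc τ]
      refine (hPSP _).trans ?_
      rw [norm_smul, Complex.norm_real, Real.norm_eq_abs, abs_of_pos hτ0, norm_sub_rev]
      gcongr
  let X : E →L[ℂ] E := ((Units.oneSub T (hTq.trans_lt hq1))⁻¹ : (E →L[ℂ] E)ˣ)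
  have hXT : X * (1 - T) = 1 := (Units.oneSub T (hTq.trans_lt hq1)).inv_mul
  have hXn : ‖X‖ ≤ (1 - q)⁻¹ := by
    have h1 : X = 1 + X * T := by
      rw [mul_sub, mul_one] at hXT
      rw [← hXT, sub_add_cancel]
    have h2 : ‖X‖ ≤ 1 + ‖X‖ * q := by
      calc ‖X‖ = ‖1 + X * T‖ := by rw [← h1]
        _ ≤ ‖(1 : E →L[ℂ] E)‖ + ‖X‖ * ‖T‖ :=
          (norm_add_le _ _).trans (add_le_add le_rfl (norm_mul_le _ _))
        _ ≤ 1 + ‖X‖ * q := by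
          gcongr
          exact ContinuousLinearMap.norm_id_le
    rw [← one_div, le_div_iff₀ h1q]
    linarith
  -- The Galerkin equations as a fixed point: `P w = w` gives `T w = w - τ P A w`, and `P A w = P A
  -- x`.
  have hwX : w = X (((τ : ℂ) • P) (A x)) := by
    have h1 : (1 - T) w = ((τ : ℂ) • P) (A x) := by
      have h2 : T w = w - (τ : ℂ) • P (A w) := by
        rw [hT, mul_apply_eq_comp, mul_apply_eq_comp, hPw, hG, sub_apply,
          smul_apply, one_apply_eq_self, map_sub, map_smul, hPw]
      rw [sub_apply, one_apply_eq_self, h2, sub_sub_cancel, hPA, smul_apply]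
    rw [← h1, ← mul_apply_eq_comp, hXT, one_apply_eq_self]
  have hτP : ‖(τ : ℂ) • P‖ ≤ τ := by
    rw [norm_smul, Complex.norm_real, Real.norm_eq_abs, abs_of_pos hτ0]
    exact mul_le_of_le_one_right hτ0.le hPn
  have e1 := hs₁ A hAb le_rfl M x hx
  have e2 := hs₂ ((τ : ℂ) • P) ((hPb.smul _).bandApprox δ) hτP _ _ e1
  have e3 := hs₃ X (hX T X hTb hTq hXT hXn) hXn _ _ e2
  rw [← hwX] at e3
  have e4 := e1.sub ht.le (hs₁ A hAb le_rfl _ _ e3)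
  exact e4.mono (le_of_eq (by ring))

end Banded

/-! ### Completeness of the trigonometric system in `L²(Ω)` -/

/-- The scaling `t ↦ 2π t` from the unit torus turns `φ_k` into a multiple of the monomial `mFourier
k` and Haar measure into a multiple of Lebesgue measure on `Ω`. The claim becomes completeness of
the Fourier basis of the torus. -/
theorem eq_zero_of_integral_conj_phiFn {d : ℕ} (f : L2 d)
    (h : ∀ k, ∫ x in Ω d, f x * (starRingEnd ℂ) (phiFn k x) = 0) : f = 0 := by
  -- Normalizes the volume of the circle to Haar probability, the measure for which `mFourierBasis`
  -- is orthonormal.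
  let _ : MeasureSpace UnitAddCircle := ⟨AddCircle.haarAddCircle⟩
  let e := UnitAddTorus.measurableEquivPiIoc (fun _ : Fin d => (0 : ℝ))
  let g : UnitAddTorus (Fin d) → (Fin d → ℝ) := fun t => (2 * Real.pi) • (e t).1
  have hπ : 2 * Real.pi ≠ 0 := by positivity
  set S : Set (Fin d → ℝ) := {x | ∀ i, x i ∈ Ioc (0 : ℝ) (0 + 1)} with hS
  set S' : Set (Fin d → ℝ) := Set.pi univ fun _ => Ioc (0 : ℝ) (2 * Real.pi) with hS'
  have hSm : MeasurableSet S := MeasurableSet.univ_pi' fun _ => measurableSet_Ioc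
  have hS'm : MeasurableSet S' := MeasurableSet.univ_pi fun _ => measurableSet_Ioc
  have hval : Measurable fun t => (e t).1 := measurable_subtype_coe.comp e.measurable
  have hsm : Measurable fun x : Fin d → ℝ => (2 * Real.pi) • x := measurable_const_smul _
  have hgm : Measurable g := hsm.comp hval
  set c := ENNReal.ofReal |((2 * Real.pi) ^ Module.finrank ℝ (Fin d → ℝ))⁻¹| with hc
  have hc0 : c ≠ 0 := by
    rw [hc, Ne, ENNReal.ofReal_eq_zero, not_le]
    positivity
  have hmap : Measure.map g volume = c • μΩ d := by
    have h1 : Measure.map (fun t => (e t).1) volume = volume.restrict S := by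
      have h0 : Measure.map (β := S) e volume = Measure.comap (Subtype.val : S → _) volume :=
        (UnitAddTorus.measurePreserving_equivPiIoc (fun _ : Fin d => (0 : ℝ))).map_eq
      rw [← map_comap_subtype_coe hSm, ← h0]
      refine (Eq.trans ?_ (Measure.map_map measurable_subtype_coe e.measurable).symm)
      rfl
    have h2 : (fun x : Fin d → ℝ => (2 * Real.pi) • x) ⁻¹' S' = S := by
      ext x
      simp only [hS, hS', mem_preimage, mem_univ_pi, mem_ofPred_eq, mem_Ioc, Pi.smul_apply,
        smul_eq_mul, zero_add]
      refine forall_congr' fun i => and_congr ?_ ?_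
      · exact mul_pos_iff_of_pos_left (by positivity)
      · exact mul_le_iff_le_one_right (by positivity)
    have h3 : (volume : Measure (Fin d → ℝ)).restrict S' = μΩ d := by
      refine Measure.restrict_congr_set ?_
      rw [volume_pi]
      exact Measure.univ_pi_Ioc_ae_eq_Icc.trans Measure.univ_pi_Ioo_ae_eq_Icc.symm
    calc Measure.map g volume
        = Measure.map (fun x => (2 * Real.pi) • x) (Measure.map (fun t => (e t).1) volume) :=
          (Measure.map_map hsm hval).symm
      _ = (Measure.map (fun x => (2 * Real.pi) • x) volume).restrict S' := by
          rw [h1, Measure.restrict_map hsm hS'm, h2]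
      _ = c • μΩ d := by
          rw [Measure.map_addHaar_smul volume hπ, Measure.restrict_smul, h3]
  have hfm : StronglyMeasurable (f : (Fin d → ℝ) → ℂ) := Lp.stronglyMeasurable f
  have hF : MemLp (fun t => f (g t)) 2 volume := by
    refine (memLp_map_measure_iff hfm.aestronglyMeasurable hgm.aemeasurable).mp ?_
    rw [hmap]
    exact (Lp.memLp f).smul_measure ENNReal.ofReal_ne_top
  have hphi : ∀ k t, phiFn k (g t) =
      (((2 * Real.pi) ^ (-(d : ℝ) / 2) : ℝ) : ℂ) * UnitAddTorus.mFourier k t := by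
    intro k t
    have ht : t = fun i => (((e t).1 i : ℝ) : UnitAddCircle) := (e.symm_apply_apply t).symm
    have hm : UnitAddTorus.mFourier k t =
        ∏ i, fourier (k i) (((e t).1 i : ℝ) : UnitAddCircle) := by
      conv_lhs => rw [ht]
      rfl
    rw [phiFn, hm]
    congr 1
    simp only [fourier_coe_apply]
    rw [← Complex.exp_sum, Finset.mul_sum]
    congr 1
    refine Finset.sum_congr rfl fun i _ => ?_
    simp only [g, Pi.smul_apply, smul_eq_mul]
    push_cast
    ring
  have hcoef : ∀ k, UnitAddTorus.mFourierCoeff (fun t => f (g t)) k = 0 := by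
    intro k
    have h1 : ∫ t, f (g t) * (starRingEnd ℂ) (phiFn k (g t)) = 0 := by
      have := integral_map (μ := (volume : Measure (UnitAddTorus (Fin d)))) hgm.aemeasurable
        (f := fun x => f x * (starRingEnd ℂ) (phiFn k x)) (hfm.mul
          (Complex.continuous_conj.comp (contDiff_phiFn k).continuous).stronglyMeasurable
            |>.aestronglyMeasurable)
      rw [← this, hmap, integral_smul_measure, h k, smul_zero]
    have h2 : ∀ t, f (g t) * (starRingEnd ℂ) (phiFn k (g t)) =
        (((2 * Real.pi) ^ (-(d : ℝ) / 2) : ℝ) : ℂ) *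
          (UnitAddTorus.mFourier (-k) t • f (g t)) := by
      intro t
      rw [hphi, UnitAddTorus.mFourier_neg, map_mul, Complex.conj_ofReal, smul_eq_mul]
      ring
    simp only [h2] at h1
    rw [integral_const_mul] at h1
    refine (mul_eq_zero.mp h1).resolve_left ?_
    exact Complex.ofReal_ne_zero.mpr (by positivity)
  have hz : hF.toLp (fun t => f (g t)) = 0 := by
    apply UnitAddTorus.mFourierBasis.repr.injective
    ext k
    rw [UnitAddTorus.mFourierBasis_repr, map_zero, lp.coeFn_zero, Pi.zero_apply, ← hcoef k]
    refine integral_congr_ae ?_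
    filter_upwards [hF.coeFn_toLp] with t ht
    rw [ht]
  have hz2 : ∀ᵐ t : UnitAddTorus (Fin d), f (g t) = 0 := by
    filter_upwards [hF.coeFn_toLp, Lp.coeFn_zero ℂ 2 (volume : Measure (UnitAddTorus (Fin d)))]
      with t ht ht0
    rw [← ht, hz, ht0, Pi.zero_apply]
  have hz3 : ∀ᵐ x ∂(c • μΩ d), f x = 0 := by
    rw [← hmap]
    exact (ae_map_iff hgm.aemeasurable
      (hfm.measurableSet_eq_fun stronglyMeasurable_const)).mpr hz2
  rw [Lp.eq_zero_iff_ae_eq_zero]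
  exact (Measure.ae_ennreal_smul_measure_iff hc0).mp hz3

variable {d : ℕ}

/-! ### The Fourier basis of `H¹_p(Ω)` -/

theorem inner_phiL2 (k : Fin d → ℤ) (f : L2 d) :
    inner ℂ (phiL2 k) f = ∫ x in Ω d, f x * (starRingEnd ℂ) (phiFn k x) := by
  rw [L2.inner_def]
  refine integral_congr_ae ?_
  have h0 : (phiL2 k : (Fin d → ℝ) → ℂ) =ᵐ[μΩ d] phiFn k := MemLp.coeFn_toLp _
  filter_upwards [h0] with x hx
  rw [hx]
  rfl

theorem eq_zero_of_inner_phiL2 {f : L2 d} (h : ∀ k, inner ℂ (phiL2 k) f = 0) : f = 0 :=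
  eq_zero_of_integral_conj_phiFn f fun k => by rw [← inner_phiL2, h]

theorem conj_phiFn (k : Fin d → ℤ) (x : Fin d → ℝ) :
    (starRingEnd ℂ) (phiFn k x) = phiFn (-k) x := by
  rw [phiFn, phiFn, map_mul, Complex.conj_ofReal, ← Complex.exp_conj]
  simp

theorem phiFn_mul (k l : Fin d → ℤ) (x : Fin d → ℝ) :
    phiFn k x * phiFn l x = (((2 * Real.pi) ^ (-(d : ℝ) / 2) : ℝ) : ℂ) * phiFn (k + l) x := by
  have h : Complex.I * ∑ j, (((k + l) j : ℝ) : ℂ) * ((x j : ℝ) : ℂ) =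
      Complex.I * ∑ j, ((k j : ℝ) : ℂ) * ((x j : ℝ) : ℂ) +
        Complex.I * ∑ j, ((l j : ℝ) : ℂ) * ((x j : ℝ) : ℂ) := by
    rw [← mul_add, ← Finset.sum_add_distrib]
    congr 1
    refine Finset.sum_congr rfl fun j _ => ?_
    rw [Pi.add_apply]
    push_cast
    ring
  rw [phiFn, phiFn, phiFn, h, Complex.exp_add]
  ring

/-- If `m j ≠ 0`, then `φ_m` is a multiple of `∂_j φ_m`, whose integral over the cell vanishes by
periodicity. -/
theorem integral_phiFn_eq_zero {m : Fin d → ℤ} (hm : m ≠ 0) : ∫ x in Ω d, phiFn m x = 0 := by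
  obtain ⟨j, hj⟩ := Function.ne_iff.mp hm
  have h := integral_pderiv_eq_zero (contDiff_phiFn m) (isPeriodic_phiFn m) j
  simp only [pderiv_phiFn] at h
  rw [integral_const_mul] at h
  refine (mul_eq_zero.mp h).resolve_left (mul_ne_zero Complex.I_ne_zero ?_)
  exact_mod_cast hj

theorem integral_phiFn_zero :
    (((2 * Real.pi) ^ (-(d : ℝ) / 2) : ℝ) : ℂ) * ∫ x in Ω d, phiFn (0 : Fin d → ℤ) x = 1 := by
  have h0 : ∀ x, phiFn (0 : Fin d → ℤ) x = (((2 * Real.pi) ^ (-(d : ℝ) / 2) : ℝ) : ℂ) := by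
    intro x
    simp [phiFn]
  have hv : (μΩ d).real univ = (2 * Real.pi) ^ d := by
    rw [measureReal_restrict_apply_univ, Measure.real, Ω, volume_pi, Measure.pi_pi]
    simp [Real.pi_pos.le]
  simp only [h0]
  rw [integral_const, hv, Complex.real_smul, ← Complex.ofReal_mul, ← Complex.ofReal_mul,
    Complex.ofReal_eq_one, ← Real.rpow_natCast, ← Real.rpow_add (by positivity),
    ← Real.rpow_add (by positivity)]
  ring_nf
  exact Real.rpow_zero _

theorem coeffV_phi (k l : Fin d → ℤ) : coeffV (phi l) k = if k = l then 1 else 0 := by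
  have h : coeffV (phi l) k =
      (((2 * Real.pi) ^ (-(d : ℝ) / 2) : ℝ) : ℂ) * ∫ x in Ω d, phiFn (l - k) x := by
    rw [coeffV, ← integral_const_mul]
    refine integral_congr_ae ?_
    have h0 : (phiL2 l : (Fin d → ℝ) → ℂ) =ᵐ[μΩ d] phiFn l := MemLp.coeFn_toLp _
    filter_upwards [h0] with x hx
    rw [sub_eq_add_neg, ← phiFn_mul, ← conj_phiFn, ← hx]
    rfl
  rw [h]
  split_ifs with hkl
  · rw [hkl, sub_self, integral_phiFn_zero]
  · rw [integral_phiFn_eq_zero (sub_ne_zero.mpr (Ne.symm hkl)), mul_zero]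

theorem inner_phiL2_toFn (k : Fin d → ℤ) (v : H1p d) :
    inner ℂ (phiL2 k) (toFn v) = coeffV v k := inner_phiL2 k _

/-- The definition of the periodic weak gradient, tested with `φ_{-k}`, the conjugate of `φ_k`. -/
theorem inner_phiL2_grad (k : Fin d → ℤ) (v : H1p d) (j : Fin d) :
    inner ℂ (phiL2 k) (grad v j) = Complex.I * ((k j : ℝ) : ℂ) * coeffV v k := by
  have h := v.2 (phiFn (-k)) (contDiff_phiFn _) (isPeriodic_phiFn _) j
  have h' : ∫ x in Ω d, toFn v x * pderiv j (phiFn (-k)) x =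
      - ∫ x in Ω d, grad v j x * phiFn (-k) x := h
  have h1 : ∀ x, toFn v x * pderiv j (phiFn (-k)) x =
      -(Complex.I * ((k j : ℝ) : ℂ)) * (toFn v x * (starRingEnd ℂ) (phiFn k x)) := by
    intro x
    rw [pderiv_phiFn, conj_phiFn, Pi.neg_apply]
    push_cast
    ring
  simp only [h1] at h'
  rw [integral_const_mul, neg_mul, neg_inj] at h'
  rw [inner_phiL2, coeffV, h']
  simp only [conj_phiFn]

theorem cfac_pos (k : Fin d → ℤ) : 0 < cfac k := Real.sqrt_pos.mpr (by positivity)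

theorem cfac_sq (k : Fin d → ℤ) : cfac k ^ 2 = 1 + ∑ j, ((k j : ℝ)) ^ 2 := by
  rw [cfac, Real.sq_sqrt (by positivity), euclNorm, Real.sq_sqrt (by positivity)]

theorem inner_H1p (u v : H1p d) :
    inner ℂ u v = inner ℂ (toFn u) (toFn v) + ∑ j, inner ℂ (grad u j) (grad v j) := by
  change inner ℂ (u : L2Pair d) (v : L2Pair d) = _
  rw [WithLp.prod_inner_apply, PiLp.inner_apply]
  rfl

/-- The function part contributes `1` and the gradient part `|k|²` to the weight. Orthogonality of
the `φ_k` in `H¹_p(Ω)` and `‖φ_k‖ = c_k` follow. -/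
theorem inner_phi (k : Fin d → ℤ) (v : H1p d) :
    inner ℂ (phi k) v = ((cfac k ^ 2 : ℝ) : ℂ) * coeffV v k := by
  have h1 : toFn (phi k) = phiL2 k := rfl
  have h2 : ∀ j, grad (phi k) j = (Complex.I * ((k j : ℝ) : ℂ)) • phiL2 k := fun _ => rfl
  rw [inner_H1p, h1, inner_phiL2_toFn, cfac_sq]
  simp only [h2, inner_smul_left, inner_phiL2_grad, map_mul, Complex.conj_I, Complex.conj_ofReal]
  push_cast
  rw [add_mul, one_mul, Finset.sum_mul]
  congr 1
  refine Finset.sum_congr rfl fun j _ => ?_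
  linear_combination (-((k j : ℂ)) ^ 2 * coeffV v k) * Complex.I_mul_I

theorem inner_smul_left_H1p (c : ℂ) (u v : H1p d) :
    inner ℂ (c • u) v = (starRingEnd ℂ) c * inner ℂ u v := inner_smul_left (E := H1p d) u v c

theorem inner_smul_right_H1p (c : ℂ) (u v : H1p d) :
    inner ℂ u (c • v) = c * inner ℂ u v := inner_smul_right (E := H1p d) u v c

theorem continuous_integral_mul {g : (Fin d → ℝ) → ℂ} (hg : Continuous g) :
    Continuous fun f : L2 d => ∫ x in Ω d, f x * g x := by
  have hc : Continuous fun x => (starRingEnd ℂ) (g x) := Complex.continuous_conj.comp hg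
  have h : (fun f : L2 d => ∫ x in Ω d, f x * g x) =
      fun f : L2 d => inner ℂ ((memLp_of_continuous hc).toLp _) f := by
    funext f
    rw [L2.inner_def]
    refine integral_congr_ae ?_
    filter_upwards [(memLp_of_continuous hc).coeFn_toLp (μ := μΩ d)] with x hx
    rw [hx]
    simp
  rw [h]
  exact continuous_const.inner continuous_id

/-- For a fixed test function both sides of the integration by parts formula are continuous in the
pair. Closedness gives the completeness needed for the basis and for the Riesz map. -/
theorem isClosed_H1p : IsClosed (H1p d : Set (L2Pair d)) := by
  have h : (H1p d : Set (L2Pair d)) = ⋂ (ψ : (Fin d → ℝ) → ℂ) (_ : ContDiff ℝ ∞ ψ)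
      (_ : IsPeriodic ψ) (j : Fin d), {p : L2Pair d |
        ∫ x in Ω d, p.fst x * pderiv j ψ x = - ∫ x in Ω d, p.snd j x * ψ x} := by
    ext p
    simp only [mem_iInter]
    rfl
  rw [h]
  refine isClosed_iInter fun ψ => isClosed_iInter fun hψ => isClosed_iInter fun _ =>
    isClosed_iInter fun j => isClosed_eq ?_ ?_
  · exact (continuous_integral_mul (continuous_pderiv hψ j)).comp (WithLp.continuous_fst 2 _ _)
  · exact ((continuous_integral_mul hψ.continuous).comp
      ((PiLp.continuous_apply 2 _ j).comp (WithLp.continuous_snd 2 _ _))).neg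

instance instCompleteSpaceH1p : CompleteSpace (H1p d) := isClosed_H1p.completeSpace_coe

theorem eq_zero_of_coeffV {v : H1p d} (h : ∀ k, coeffV v k = 0) : v = 0 := by
  have h1 : toFn v = 0 := eq_zero_of_inner_phiL2 fun k => by rw [inner_phiL2_toFn, h]
  have h2 : ∀ j, grad v j = 0 := fun j =>
    eq_zero_of_inner_phiL2 fun k => by rw [inner_phiL2_grad, h, mul_zero]
  rw [← inner_self_eq_zero (𝕜 := ℂ), inner_H1p, h1]
  simp [h2]

theorem orthonormal_phi :
    Orthonormal ℂ fun k : Fin d → ℤ => (((cfac k)⁻¹ : ℝ) : ℂ) • (phi k : H1p d) := by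
  classical
  rw [orthonormal_iff_ite]
  intro k l
  rw [inner_smul_left_H1p, inner_smul_right_H1p, inner_phi, coeffV_phi, Complex.conj_ofReal]
  split_ifs with h
  · subst h
    have := (cfac_pos k).ne'
    rw [mul_one, ← Complex.ofReal_mul, ← Complex.ofReal_mul, Complex.ofReal_eq_one]
    field_simp
  · simp

/-- The orthonormal basis `φ_k / c_k` of `H¹_p(Ω)`. -/
def phiBasis (d : ℕ) : HilbertBasis (Fin d → ℤ) ℂ (H1p d) :=
  HilbertBasis.mkOfOrthogonalEqBot orthonormal_phi (by
    rw [Submodule.eq_bot_iff]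
    intro v hv
    refine eq_zero_of_coeffV fun k => ?_
    have h := (Submodule.mem_orthogonal _ _).mp hv _ (Submodule.subset_span ⟨k, rfl⟩)
    have hc := (cfac_pos k).ne'
    rw [inner_smul_left_H1p, inner_phi] at h
    simpa [hc] using h)

theorem phiBasis_apply (k : Fin d → ℤ) : phiBasis d k = (((cfac k)⁻¹ : ℝ) : ℂ) • phi k := by
  rw [phiBasis, HilbertBasis.coe_mkOfOrthogonalEqBot]

theorem phiBasis_repr (v : H1p d) (k : Fin d → ℤ) :
    (phiBasis d).repr v k = (cfac k : ℂ) * coeffV v k := by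
  have hc : (cfac k : ℂ) ≠ 0 := Complex.ofReal_ne_zero.mpr (cfac_pos k).ne'
  rw [HilbertBasis.repr_apply_apply, phiBasis_apply, inner_smul_left_H1p, inner_phi]
  rw [Complex.conj_ofReal]
  push_cast
  field_simp

theorem phiBasis_repr_projV (Λ : Finset (Fin d → ℤ)) (v : H1p d) (l : Fin d → ℤ) :
    (phiBasis d).repr (projV Λ v) l = (Λ : Set (Fin d → ℤ)).indicator ((phiBasis d).repr v) l := by
  classical
  have h : coeffV (projV Λ v) l = if l ∈ Λ then coeffV v l else 0 := by
    rw [← inner_phiL2_toFn]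
    have h1 : toFn (projV Λ v) = ∑ k ∈ Λ, coeffV v k • toFn (phi k) := by
      let F : H1p d →ₗ[ℂ] L2 d :=
        { toFun := toFn, map_add' := fun _ _ => rfl, map_smul' := fun _ _ => rfl }
      change F (projV Λ v) = ∑ k ∈ Λ, coeffV v k • F (phi k)
      rw [projV, map_sum]
      simp only [map_smul]
    rw [h1, inner_sum]
    simp only [inner_smul_right, inner_phiL2_toFn, coeffV_phi]
    simp
  rw [phiBasis_repr, h, Set.indicator_apply]
  simp only [Finset.mem_coe, phiBasis_repr]
  split_ifs <;> simp

/-! ### Sparsity classes in `H¹_p(Ω)` -/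

theorem suppIn_projV (Λ : Finset (Fin d → ℤ)) (v : H1p d) :
    SuppIn (phiBasis d) Λ (projV Λ v) := by
  intro k hk
  rw [phiBasis_repr_projV] at hk
  exact Set.mem_of_indicator_ne_zero hk

/-- The coordinate projection onto the complement of `Λ'` kills `y` and maps `v - y` to `v - projV
Λ' v`. -/
theorem norm_sub_projV_le {Λ Λ' : Finset (Fin d → ℤ)} (hΛ : Λ ⊆ Λ') {v y : H1p d}
    (hy : SuppIn (phiBasis d) Λ y) : ‖v - projV Λ' v‖ ≤ ‖v - y‖ := by
  classical
  obtain ⟨Q, hQ, hQn⟩ := exists_diagonal (phiBasis d) 0 (fun l => if l ∈ Λ' then 0 else 1)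
    zero_le_one (fun l => by split_ifs <;> simp)
  have h : v - projV Λ' v = Q (v - y) := by
    apply (phiBasis d).repr.injective
    ext l
    rw [hQ, map_sub, map_sub, lp.coeFn_sub, lp.coeFn_sub, Pi.sub_apply, Pi.sub_apply,
      phiBasis_repr_projV, sub_zero, Set.indicator_apply]
    by_cases hl : l ∈ Λ'
    · simp [hl]
    · have hyl : (phiBasis d).repr y l = 0 := by
        by_contra hne
        exact hl (hΛ (hy l hne))
      simp [hl, hyl]
  rw [h]
  calc ‖Q (v - y)‖ ≤ ‖Q‖ * ‖v - y‖ := Q.le_opNorm _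
    _ ≤ 1 * ‖v - y‖ := by gcongr
    _ = ‖v - y‖ := one_mul _

theorem bestErrV_le (hd : 1 ≤ d) {N : ℕ} {Λ : Finset (Fin d → ℤ)} {v y : H1p d}
    (hΛ : Λ.card ≤ N) (hy : SuppIn (phiBasis d) Λ y) : bestErrV N v ≤ ‖v - y‖ := by
  have : Nonempty (Fin d) := ⟨⟨0, hd⟩⟩
  -- `E_N` asks for exactly `N` indices, so `Λ` is padded; the index lattice is infinite because `d
  -- ≥ 1`.
  obtain ⟨Λ', hΛ', hcard⟩ := Infinite.exists_superset_card_eq Λ N hΛ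
  refine le_trans ?_ (norm_sub_projV_le hΛ' hy)
  exact ciInf_le ⟨0, by rintro _ ⟨_, rfl⟩; exact norm_nonneg _⟩
    (⟨Λ', hcard⟩ : {Λ : Finset (Fin d → ℤ) // Λ.card = N})

theorem ABnormV_le_of_sparse (hd : 1 ≤ d) {s M : ℝ} {v : H1p d}
    (hv : Sparse (phiBasis d) (s / d) M v) : ABnormV s v ≤ ENNReal.ofReal (2 * M) := by
  have hM := hv.nonneg
  rw [two_mul, ENNReal.ofReal_add hM hM]
  refine add_le_add (ENNReal.ofReal_le_ofReal hv.1) (iSup₂_le fun N hN => ?_)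
  refine ENNReal.ofReal_le_ofReal ?_
  obtain ⟨Λ, y, hc, hy, he⟩ := hv.2 N hN
  have hN0 : (0 : ℝ) < N := by exact_mod_cast hN
  calc bestErrV N v * (N : ℝ) ^ (s / d) ≤ M * (N : ℝ) ^ (-(s / d)) * (N : ℝ) ^ (s / d) := by
        gcongr
        exact (bestErrV_le hd hc hy).trans he
    _ = M := by rw [mul_assoc, ← Real.rpow_add hN0, neg_add_cancel, Real.rpow_zero, mul_one]

theorem sparse_of_ABnormV (hd : 1 ≤ d) {s : ℝ} {v : H1p d} (hv : ABnormV s v ≠ ⊤) :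
    Sparse (phiBasis d) (s / d) (2 * (ABnormV s v).toReal) v := by
  have : Nonempty (Fin d) := ⟨⟨0, hd⟩⟩
  set M := (ABnormV s v).toReal with hM
  have hM0 : 0 ≤ M := ENNReal.toReal_nonneg
  have h1 : ‖v‖ ≤ M := by
    rw [hM, ← ENNReal.ofReal_le_iff_le_toReal hv]
    exact le_self_add
  refine ⟨by linarith, fun N hN => ?_⟩
  have hN0 : (0 : ℝ) < N := by exact_mod_cast hN
  rcases hM0.eq_or_lt with hz | hpos
  · have hv0 : v = 0 := norm_le_zero_iff.mp (h1.trans hz.ge)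
    exact ⟨∅, 0, by simp, suppIn_zero _, by rw [hv0, sub_zero, norm_zero]; positivity⟩
  · have h2 : bestErrV N v * (N : ℝ) ^ (s / d) ≤ M := by
      rw [hM, ← ENNReal.ofReal_le_iff_le_toReal hv]
      exact le_add_of_nonneg_of_le zero_le
        (le_iSup₂ (f := fun (N : ℕ) (_ : 1 ≤ N) =>
          ENNReal.ofReal (bestErrV N v * (N : ℝ) ^ (s / (d : ℝ)))) N hN)
    have h3 : bestErrV N v ≤ M * (N : ℝ) ^ (-(s / d)) := by
      rwa [Real.rpow_neg hN0.le, ← div_eq_mul_inv, le_div_iff₀ (by positivity)]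
    -- The factor `2` makes the inequality strict, so that some index set realizes it without the
    -- infimum having to be attained.
    have h4 : bestErrV N v < 2 * M * (N : ℝ) ^ (-(s / d)) := by
      have : 0 < M * (N : ℝ) ^ (-(s / d)) := by positivity
      linarith
    obtain ⟨Λ₀, -, hcard₀⟩ := Infinite.exists_superset_card_eq (∅ : Finset (Fin d → ℤ)) N (by simp)
    have : Nonempty {Λ : Finset (Fin d → ℤ) // Λ.card = N} := ⟨⟨Λ₀, hcard₀⟩⟩
    obtain ⟨Λ, hΛ⟩ := exists_lt_of_ciInf_lt h4
    exact ⟨Λ.1, projV Λ.1 v, Λ.2.le, suppIn_projV _ _, hΛ.le⟩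

/-! ### The Riesz isomorphism between `H¹_p(Ω)` and `H⁻¹_p(Ω)` -/

/-- The conjugate-linear form `v ↦ (w, v)` of `w` in a Hilbert space. -/
def rieszForm (E : Type*) [NormedAddCommGroup E] [InnerProductSpace ℂ E] [CompleteSpace E] :
    E ≃ₗᵢ[ℂ] (E →L⋆[ℂ] ℂ) :=
  LinearIsometryEquiv.ofSurjective
    { toLinearMap := ((innerSL ℂ : E →L⋆[ℂ] E →L[ℂ] ℂ).flip : E →ₗ[ℂ] (E →L⋆[ℂ] ℂ))
      norm_map' := fun w => by
        refine le_antisymm (ContinuousLinearMap.opNorm_le_bound _ (norm_nonneg _) fun v => ?_) ?_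
        · rw [mul_comm]
          exact norm_inner_le_norm v w
        · rcases eq_or_ne w 0 with rfl | hw
          · simp
          · have h := ((innerSL ℂ : E →L⋆[ℂ] E →L[ℂ] ℂ).flip w).le_opNorm w
            rw [ContinuousLinearMap.flip_apply, innerSL_apply_apply, inner_self_eq_norm_sq_to_K,
              norm_pow, RCLike.norm_ofReal, abs_norm, sq] at h
            exact le_of_mul_le_mul_right h (norm_pos_iff.mpr hw) }
    (fun f => by
      -- The conjugate of `f` is a linear form, to which the usual Riesz theorem applies.
      let F : E →L[ℂ] ℂ := (starL ℂ : ℂ ≃L⋆[ℂ] ℂ).toContinuousLinearMap.comp f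
      refine ⟨(InnerProductSpace.toDual ℂ E).symm F, ?_⟩
      ext v
      change inner ℂ v ((InnerProductSpace.toDual ℂ E).symm F) = f v
      rw [← inner_conj_symm, InnerProductSpace.toDual_symm_apply]
      exact star_star (f v))

theorem rieszForm_apply {E : Type*} [NormedAddCommGroup E] [InnerProductSpace ℂ E]
    [CompleteSpace E] (w v : E) : rieszForm E w v = inner ℂ v w := rfl

theorem rieszForm_sub {E : Type*} [NormedAddCommGroup E] [InnerProductSpace ℂ E]
    [CompleteSpace E] (u w : E) : rieszForm E (u - w) = rieszForm E u - rieszForm E w :=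
  map_sub _ _ _

theorem rieszForm_sum_smul {E ι : Type*} [NormedAddCommGroup E] [InnerProductSpace ℂ E]
    [CompleteSpace E] (s : Finset ι) (a : ι → ℂ) (w : ι → E) :
    rieszForm E (∑ i ∈ s, a i • w i) = ∑ i ∈ s, a i • rieszForm E (w i) := by
  rw [map_sum]
  simp only [map_smul]

/-- Two weights cancel: the dual coefficient of the form of `w` is `c_k²` times its Fourier
coefficient, while `φ_k`, taken as an `L²` form, is `c_k⁻²` times its Riesz form. -/
theorem projV'_rieszForm (Λ : Finset (Fin d → ℤ)) (w : H1p d) :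
    projV' Λ (rieszForm (H1p d) w) = rieszForm (H1p d) (projV Λ w) := by
  refine Eq.trans ?_ (rieszForm_sum_smul (E := H1p d) Λ (coeffV w) phi).symm
  refine Finset.sum_congr rfl fun k _ => ?_
  ext v
  have h1 : formOfL2 (phiL2 k) v = (starRingEnd ℂ) (coeffV v k) := by
    rw [← inner_phiL2_toFn, inner_conj_symm]
    rfl
  have h2 : inner ℂ v (phi k) = ((cfac k ^ 2 : ℝ) : ℂ) * (starRingEnd ℂ) (coeffV v k) := by
    rw [← Complex.conj_ofReal, ← map_mul, ← inner_phi]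
    exact (inner_conj_symm (𝕜 := ℂ) (E := H1p d) v (phi k)).symm
  rw [smul_apply, smul_apply, coeffV', rieszForm_apply, rieszForm_apply, h1, inner_phi, h2,
    smul_eq_mul, smul_eq_mul]
  ring

theorem bestErrV'_rieszForm (N : ℕ) (w : H1p d) :
    bestErrV' N (rieszForm (H1p d) w) = bestErrV N w := by
  rw [bestErrV', bestErrV]
  refine iInf_congr fun Λ => ?_
  rw [projV'_rieszForm, ← LinearIsometryEquiv.norm_map (rieszForm (H1p d))]
  exact congrArg norm (rieszForm_sub (E := H1p d) _ _).symm

theorem ABnormV'_rieszForm (s : ℝ) (w : H1p d) :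
    ABnormV' s (rieszForm (H1p d) w) = ABnormV s w := by
  rw [ABnormV', ABnormV, LinearIsometryEquiv.norm_map]
  simp only [bestErrV'_rieszForm]

/-! ### The elliptic operator -/

theorem re_integral_mul_le {m : (Fin d → ℝ) → ℝ} (hm : AEStronglyMeasurable m (μΩ d)) {lo hi : ℝ}
    (hlo : 0 < lo) (hb : ∀ x ∈ Ω d, lo ≤ m x ∧ m x ≤ hi) (f : L2 d) :
    lo * ‖f‖ ^ 2 ≤ (∫ x in Ω d, (m x : ℂ) * (f x * (starRingEnd ℂ) (f x))).re := by
  obtain ⟨_, hT⟩ := exists_mulL2 hm ⟨lo, hi, hlo, hb⟩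
  have hi1 := (hT f f).1
  have h1 : ‖f‖ ^ 2 = ∫ x in Ω d, ‖f x‖ ^ 2 := by
    rw [← @inner_self_eq_norm_sq ℂ, L2.inner_def, ← integral_re (L2.integrable_inner f f)]
    simp only [inner_self_eq_norm_sq]
  have h2 : ∀ x, ((m x : ℂ) * (f x * (starRingEnd ℂ) (f x))).re = m x * ‖f x‖ ^ 2 := by
    intro x
    rw [Complex.mul_conj, ← Complex.ofReal_mul, Complex.ofReal_re, Complex.normSq_eq_norm_sq]
  have h3 : (∫ x in Ω d, (m x : ℂ) * (f x * (starRingEnd ℂ) (f x))).re =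
      ∫ x in Ω d, m x * ‖f x‖ ^ 2 := by
    have := integral_re hi1
    simp only [RCLike.re_eq_complex_re, h2] at this
    exact this.symm
  have hi2 : Integrable (fun x => m x * ‖f x‖ ^ 2) (μΩ d) := by
    have := hi1.re
    simpa only [RCLike.re_eq_complex_re, h2] using this
  have hi3 : Integrable (fun x => lo * ‖f x‖ ^ 2) (μΩ d) := by
    have := (L2.integrable_inner (𝕜 := ℂ) f f).re
    simp only [inner_self_eq_norm_sq] at this
    exact this.const_mul lo
  rw [h1, h3, ← integral_const_mul]
  refine integral_mono_ae hi3 hi2 ?_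
  filter_upwards [ae_restrict_mem (measurableSet_Ω d)] with x hx
  exact mul_le_mul_of_nonneg_right (hb x hx).1 (sq_nonneg _)

theorem Coefficients.exists_coercive (P : Coefficients d) :
    ∃ α, 0 < α ∧ ∀ u : H1p d, α * ‖u‖ ^ 2 ≤ (P.a u u).re := by
  obtain ⟨lo, hi, hlo, hb⟩ := P.bounds_ν
  obtain ⟨lo', hi', hlo', hb'⟩ := P.bounds_σ
  obtain ⟨_, hT⟩ := exists_mulL2 P.measurable_ν P.bounds_ν
  refine ⟨min lo lo', lt_min hlo hlo', fun u => ?_⟩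
  have h1 : ‖u‖ ^ 2 = ‖toFn u‖ ^ 2 + ∑ j, ‖grad u j‖ ^ 2 := by
    rw [← @inner_self_eq_norm_sq ℂ, inner_H1p, map_add, map_sum]
    simp only [inner_self_eq_norm_sq]
  rw [Coefficients.a]
  rw [integral_finsetSum _ fun j _ => (hT (grad u j) (grad u j)).1, Complex.add_re,
    Complex.re_sum, h1, mul_add, Finset.mul_sum, add_comm]
  refine add_le_add (Finset.sum_le_sum fun j _ => ?_) ?_
  · exact (mul_le_mul_of_nonneg_right (min_le_left _ _) (sq_nonneg _)).trans
      (re_integral_mul_le P.measurable_ν hlo hb _)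
  · exact (mul_le_mul_of_nonneg_right (min_le_right _ _) (sq_nonneg _)).trans
      (re_integral_mul_le P.measurable_σ hlo' hb' _)

/-- The operator on `H¹_p(Ω)` whose matrix in the basis `φ_k / c_k` is the stiffness matrix. -/
def Coefficients.op (P : Coefficients d) : H1p d →L[ℂ] H1p d :=
  ((rieszForm (H1p d)).symm : Hm1p d →L[ℂ] H1p d).comp P.L

theorem Coefficients.rieszForm_op (P : Coefficients d) (u : H1p d) :
    rieszForm (H1p d) (P.op u) = P.L u :=
  (rieszForm (H1p d)).apply_symm_apply _

theorem Coefficients.inner_op (P : Coefficients d) (u v : H1p d) :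
    inner ℂ v (P.op u) = P.a u v := by
  rw [← rieszForm_apply, P.rieszForm_op, P.L_apply]

theorem Coefficients.repr_op (P : Coefficients d) (u : H1p d) (l : Fin d → ℤ) :
    (phiBasis d).repr (P.op u) l = (((cfac l)⁻¹ : ℝ) : ℂ) * P.a u (phi l) := by
  rw [HilbertBasis.repr_apply_apply, phiBasis_apply, inner_smul_left_H1p, P.inner_op,
    Complex.conj_ofReal]

theorem Coefficients.repr_op_phiBasis (P : Coefficients d) (l k : Fin d → ℤ) :
    (phiBasis d).repr (P.op (phiBasis d k)) l = P.stiffness l k := by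
  rw [P.repr_op, phiBasis_apply, ← P.L_apply, map_smul, smul_apply, P.L_apply,
    Coefficients.stiffness, smul_eq_mul]
  push_cast
  rw [div_eq_mul_inv, mul_inv]
  ring

/-- Passes from decay in the Euclidean norm to decay in the maximum norm, which measures band width.
-/
theorem norm_le_euclNorm (k : Fin d → ℤ) : ‖k‖ ≤ euclNorm k := by
  refine (pi_norm_le_iff_of_nonneg (Real.sqrt_nonneg _)).mpr fun i => ?_
  rw [Int.norm_eq_abs]
  refine Real.abs_le_sqrt ?_
  exact Finset.single_le_sum (f := fun j => ((k j : ℝ)) ^ 2) (fun j _ => sq_nonneg _)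
    (Finset.mem_univ i)

theorem suppIn_of_mem_VΛ {Λ : Finset (Fin d → ℤ)} {w : H1p d} (hw : w ∈ VΛ Λ) :
    SuppIn (phiBasis d) Λ w := by
  intro k hk
  by_contra hkΛ
  refine hk ?_
  rw [phiBasis_repr, ← inner_phiL2_toFn]
  refine mul_eq_zero_of_right _ ?_
  clear hk
  induction hw using Submodule.span_induction with
  | mem x hx =>
    obtain ⟨l, hl, rfl⟩ := hx
    rw [inner_phiL2_toFn, coeffV_phi, if_neg]
    rintro rfl
    exact hkΛ hl
  | zero => exact inner_zero_right _
  | add x y _ _ hx hy =>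
    exact (inner_add_right (phiL2 k) (toFn x) (toFn y)).trans (by rw [hx, hy, add_zero])
  | smul c x _ hx =>
    exact (inner_smul_right (phiL2 k) (toFn x) c).trans (by rw [hx, mul_zero])

end

end FourierGalerkin

/-! ### Sparsity of the Galerkin residual -/

theorem mainTheorem5 (d : ℕ) (hd : 1 ≤ d) (P : FourierGalerkin.Coefficients d)
    (ηL : ℝ) (hη : (d : ℝ) < ηL) (hA : FourierGalerkin.AlgDecay ηL P.stiffness)
    (s : ℝ) (hs0 : 0 < s) (hs : s < ηL - d) :
    ∃ C : NNReal, ∀ (f : FourierGalerkin.Hm1p d) (u : FourierGalerkin.H1p d),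
      P.IsWeakSolution f u → u ∈ FourierGalerkin.ABclassV d s →
      ∀ (Λ : Finset (Fin d → ℤ)) (uΛ : FourierGalerkin.H1p d), P.IsGalerkinSolution f Λ uΛ →
        P.residual f uΛ ∈ FourierGalerkin.ABclassV' d s ∧
        FourierGalerkin.ABnormV' s (P.residual f uΛ) ≤ C * FourierGalerkin.ABnormV s u := by
  open FourierGalerkin in
  have hd0 : (0 : ℝ) < d := by exact_mod_cast hd
  obtain ⟨c, hc, hdecay⟩ := hA
  obtain ⟨α, hα, hcoer⟩ := P.exists_coercive
  obtain ⟨δ, hδ1, hδ2⟩ := exists_between hs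
  have hη0 : 0 < ηL := hd0.trans hη
  obtain ⟨C, hC, hAb⟩ := exists_bandApprox_of_decay (b := phiBasis d) (A := P.op) (c := c)
    (η := ηL) (δ := δ) hd (fun l k => by
      rw [P.repr_op_phiBasis]
      refine (hdecay l k).trans ?_
      gcongr c * ?_
      exact Real.rpow_le_rpow_of_nonpos (by positivity)
        (by linarith [norm_le_euclNorm (l - k)]) (by linarith))
    hc.le (by linarith) hδ2
  obtain ⟨K, hK, hres⟩ := exists_sparse_residual hd hα
    (fun x => by rw [P.inner_op]; exact hcoer x) hC hAb (t := s / d) (by positivity)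
    (by rwa [div_mul_cancel₀ _ hd0.ne'])
  -- Passing from `ABnormV` to `Sparse` and back costs a factor `2` each way.
  refine ⟨(4 * K).toNNReal, fun f u hu huA Λ w hw => ?_⟩
  have hfin : ABnormV s u ≠ ⊤ := ne_of_lt huA
  have hsp := hres _ u (sparse_of_ABnormV hd hfin) Λ w (suppIn_of_mem_VΛ hw.1) (fun k hk => by
    -- Galerkin orthogonality: the test function `φ_k` with `k ∈ Λ` shows that the rows of `A u_Λ`
    -- and `A u` in `Λ` agree.
    rw [P.repr_op, P.repr_op, hw.2 _ (Submodule.subset_span ⟨k, hk, rfl⟩), hu])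
  have hr : P.residual f w = rieszForm (H1p d) (P.op u - P.op w) := by
    refine Eq.trans ?_ (rieszForm_sub (E := H1p d) _ _).symm
    rw [P.rieszForm_op, P.rieszForm_op, Coefficients.residual]
    congr 1
    ext v
    rw [P.L_apply, hu]
  have hle : ABnormV' s (P.residual f w) ≤
      ENNReal.ofReal (4 * K) * ABnormV s u := by
    rw [hr, ABnormV'_rieszForm]
    refine (ABnormV_le_of_sparse hd hsp).trans (le_of_eq ?_)
    rw [← ENNReal.ofReal_toReal hfin, ← ENNReal.ofReal_mul (by positivity), ENNReal.toReal_ofReal ENNReal.toReal_nonneg]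
    congr 1
    ring
  exact ⟨lt_of_le_of_lt hle (ENNReal.mul_lt_top ENNReal.coe_lt_top huA), hle⟩
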